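/- **Setting.** Let $T>0$, $d\ge 1$, and let $\Theta\subset\mathbb R^d$ be a bounded open set. All function spaces and norms on $\Theta$ are with respect to Lebesgue measure and $\langle\cdot,\cdot\rangle$ is the $L^2(\Theta)$ inner product. Assume: * $\zeta:\mathbb R\to\mathbb R$ is Lipschitz continuous, non-decreasing, $\zeta(0)=0$, and $|\zeta(s)|\ge c|s|-b$ for all $s$, for some $c,b>0$. Put $\Xi(z)=\int_0^z\zeta(s)\,ds$. * $\Lambda$ is a measurable symmetric-matrix-valued function on $\Theta$ with $\underline\mu|\xi|^2\le\Lambda(x)\xi\cdot\xi\le\overline\mu|\xi|^2$ for all $\xi\in\mathbb R^d$ and a.e. $x\in\Theta$, where $0<\underline\mu,\overline\mu<\infty$. Put $\|F\|_\Lambda=\langle\Lambda F,F\rangle^{1/2}$. * $u_0:\Theta\to\mathbb R$ is measurable with $\Xi(u_0)\in L^1(\Theta)$ (hence $u_0\in L^2(\Theta)$). * $\mathcal K$ is a separable real Hilbert space with a countable orthonormal basis $(e_k)_k$, and $(q_k)_k$ are real numbers with $\sum_k q_k^2<\infty$. A *$\mathcal Q$-Wiener process* on a stochastic basis $(\Omega,\mathcal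 F,(\mathcal F_t)_{t\in[0,T]},\mathbb P)$ is an $(\mathcal F_t)$-adapted, a.s. continuous $\mathcal K$-valued process of the form $W(t)=\sum_k q_kW_k(t)e_k$, $t\in[0,T]$, with independent $(\mathcal F_t)$-adapted real standard Wiener processes $W_k$. * $f$ maps $L^2(\Theta)$ continuously into the Hilbert–Schmidt operators from $\mathcal K$ to $L^2(\Theta)$ (with the Hilbert–Schmidt norm), and there are $C_1,C_2>0$ such that $\|f(\zeta(w))\|_{HS}^2\le C_2\int_\Theta\Xi(w)\,dx+C_1$ for all $w\in L^2(\Theta)$ with $\Xi(w)\in L^1(\Theta)$. **Gradient discretisations.** Let $Y\subset L^2(\Theta)$ be a set of initial data containing $u_0$. A space-time gradient discretisation $\mathcal D$ consists of: a finite-dimensional real vector space $X_{\mathcal D}$ with a basis $(\mathbf e_i)_{i\in B}$ and disjoint measurable sets $\Theta_i\subset\Theta$ $(i\in B)$, with reconstruction $\Pi_{\mathcal D}v=\sum_i v_i\mathbf 1_{\Theta_i}$ for $v=\sum_iv_i\mathbf e_i$; a linear map $\nabla_{\mathcal D}:X_{\mathcal D}\to L^2(\Theta)^d$ such that $v\mapsto\|\nabla_{\mathcal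 D}v\|_{L^2(\Theta)}$ is a norm on $X_{\mathcal D}$; a map $\mathcal I_{\mathcal D}:Y\to X_{\mathcal D}$; and uniform time points $t^{(n)}=n\,\delta t_{\mathcal D}$, $n=0,\dots,N$, with $N\ge1$ and $\delta t_{\mathcal D}=T/N$. For $g:\mathbb R\to\mathbb R$ with $g(0)=0$ put $g(v)=\sum_i g(v_i)\mathbf e_i$, and for $v=(v^{(n)})_{0\le n\le N}$ let $\nabla_{\mathcal D}v(t)=\nabla_{\mathcal D}v^{(n+1)}$ for $t\in(t^{(n)},t^{(n+1)}]$. Let $(\mathcal D_m)_{m\in\mathbb N}$ be a sequence of gradient discretisations (with the same $Y$) that is * *consistent*: $\min_{w\in X_{\mathcal D_m}}(\|\Pi_{\mathcal D_m}w-\phi\|_{L^2(\Theta)}+\|\nabla_{\mathcal D_m}w-\nabla\phi\|_{L^2(\Theta)})\to0$ for all $\phi\in H^1_0(\Theta)$; for all $\phi\in Y$, $\Pi_{\mathcal D_m}\mathcal I_{\mathcal D_m}\phi\to\phi$ in $L^2(\Theta)$ and $\delta t_{\mathcal D_m}\|\nabla_{\mathcal D_m}\zeta(\mathcal I_{\mathcal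 D_m}\phi)\|_\Lambda$ is bounded in $m$; and $\delta t_{\mathcal D_m}\to0$; * *limit-conforming*: for all $\boldsymbol\phi\in L^2(\Theta)^d$ with $\operatorname{div}\boldsymbol\phi\in L^2(\Theta)$, $\max_{v\ne0}\frac{|\langle\nabla_{\mathcal D_m}v,\boldsymbol\phi\rangle+\langle\Pi_{\mathcal D_m}v,\operatorname{div}\boldsymbol\phi\rangle|}{\|\nabla_{\mathcal D_m}v\|_{L^2(\Theta)}}\to0$; * *compact*: $\sup_m\max_{v\ne0}\frac{\|\Pi_{\mathcal D_m}v(\cdot+\xi)-\Pi_{\mathcal D_m}v\|_{L^2(\mathbb R^d)}}{\|\nabla_{\mathcal D_m}v\|_{L^2(\Theta)}}\to0$ as $\xi\to0$ in $\mathbb R^d$ ($\Pi_{\mathcal D_m}v$ extended by $0$ outside $\Theta$). **Gradient scheme.** Given a $\mathcal Q$-Wiener process $W$, a solution of the gradient scheme for $\mathcal D$ is a family $u=(u^{(n)})_{0\le n\le N}$ of $X_{\mathcal D}$-valued random variables with $u^{(0)}=\mathcal I_{\mathcal D}u_0$, with $u^{(n)}$ measurable with respect to $\sigma(W(t^{(k)}):0\le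 k\le n)$, and such that for every $\phi\in X_{\mathcal D}$, almost surely, for all $n=0,\dots,N-1$, $$\langle\Pi_{\mathcal D}u^{(n+1)}-\Pi_{\mathcal D}u^{(n)},\Pi_{\mathcal D}\phi\rangle+\delta t_{\mathcal D}\langle\Lambda\nabla_{\mathcal D}\zeta(u^{(n+1)}),\nabla_{\mathcal D}\phi\rangle=\langle f(\Pi_{\mathcal D}\zeta(u^{(n)}))(W(t^{(n+1)})-W(t^{(n)})),\Pi_{\mathcal D}\phi\rangle .$$ **Lemma (a priori estimates).** There is a constant $C>0$, independent of $m$, of the stochastic basis, of the Wiener process and of the solution, such that for every $m$, every stochastic basis carrying a $\mathcal Q$-Wiener process $W$, and every solution $u$ of the gradient scheme for $\mathcal D=\mathcal D_m$, the random variable below is integrable and $$\mathbb E\Big[\max_{0\le n\le N}\int_\Theta\Xi(\Pi_{\mathcal D}u^{(n)})\,dx+\|\nabla_{\mathcal D}\zeta(u)\|^2_{L^2((0,T)\times\Theta)}+\sum_{n=0}^{N-1}\|\zeta(\Pi_{\mathcal D}u^{(n+1)})-\zeta(\Pi_{\mathcal D}u^{(n)})\|^2_{L^2(\Theta)}\Big]\le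 C.$$ -/

import Mathlib

open MeasureTheory ProbabilityTheory Filter Topology Set
open scoped ENNReal NNReal

universe u v w

namespace Stefan

noncomputable section

/-! ### The spatial domain and its Lebesgue spaces -/

/-- The space `ℝ^d` with its Euclidean norm. -/
abbrev E (d : ℕ) : Type := EuclideanSpace ℝ (Fin d)

/-- A bounded open subset of `ℝ^d`. -/
structure Domain (d : ℕ) where
  carrier : Set (E d)
  isOpen : IsOpen carrier
  isBounded : Bornology.IsBounded carrier

/-- Lebesgue measure on the domain. -/
abbrev Domain.μ {d : ℕ} (Θ : Domain d) : Measure (E d) := volume.restrict Θ.carrier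

instance {d : ℕ} (Θ : Domain d) : IsFiniteMeasure Θ.μ :=
  ⟨by simpa using Θ.isBounded.measure_lt_top⟩

/-- `L²(Θ)`. -/
abbrev L2 {d : ℕ} (Θ : Domain d) : Type := Lp ℝ 2 Θ.μ

/-- `L²(Θ)^d`. -/
abbrev L2vec {d : ℕ} (Θ : Domain d) : Type := Lp (E d) 2 Θ.μ

/-- Test functions: smooth functions with compact support contained in `Θ`. -/
structure IsTestFunction {d : ℕ} (Θ : Domain d) (ψ : E d → ℝ) : Prop where
  smooth : ContDiff ℝ (⊤ : ℕ∞) ψ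
  hasCompactSupport : HasCompactSupport ψ
  tsupport_subset : tsupport ψ ⊆ Θ.carrier

/-- `φ ∈ H¹₀(Θ)` with gradient `G`: the pair `(φ, G)` is a limit in `L²(Θ) × L²(Θ)^d` of pairs
`(ψ, ∇ψ)` with `ψ` a test function. -/
def IsH10 {d : ℕ} (Θ : Domain d) (φ : L2 Θ) (G : L2vec Θ) : Prop :=
  (φ, G) ∈ closure {p : L2 Θ × L2vec Θ | ∃ ψ : E d → ℝ, IsTestFunction Θ ψ ∧
    p.1 =ᵐ[Θ.μ] ψ ∧ p.2 =ᵐ[Θ.μ] gradient ψ}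

/-- `Φ ∈ H^div(Θ)` with weak divergence `δ ∈ L²(Θ)`. -/
def IsHdiv {d : ℕ} (Θ : Domain d) (Φ : L2vec Θ) (δ : L2 Θ) : Prop :=
  ∀ ψ : E d → ℝ, IsTestFunction Θ ψ →
    ∫ x, inner ℝ (Φ x) (gradient ψ x) ∂Θ.μ = - ∫ x, δ x * ψ x ∂Θ.μ

/-! ### The data of the problem -/

/-- Assumptions on the nonlinearity `ζ`; `K` is a Lipschitz constant of `ζ`. -/
structure IsNonlinearity (ζ : ℝ → ℝ) (K : ℝ≥0) : Prop where
  lipschitz : LipschitzWith K ζ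
  monotone : Monotone ζ
  map_zero : ζ 0 = 0
  coercive : ∃ c > 0, ∃ b > 0, ∀ s : ℝ, c * |s| - b ≤ |ζ s|

/-- `Ξ(z) = ∫₀^z ζ(s) ds`. -/
def Xi (ζ : ℝ → ℝ) (z : ℝ) : ℝ := ∫ s in (0 : ℝ)..z, ζ s

/-- Assumptions on the diffusion tensor `Λ`: measurable, symmetric, uniformly elliptic and
bounded on `Θ`. -/
structure IsDiffusionTensor {d : ℕ} (Θ : Domain d) (Λ : E d → E d →L[ℝ] E d) : Prop where
  measurable : AEStronglyMeasurable Λ Θ.μ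
  symmetric : ∀ᵐ x ∂Θ.μ, ∀ ξ η : E d, inner ℝ (Λ x ξ) η = inner ℝ ξ (Λ x η)
  elliptic_bounded : ∃ a > 0, ∃ b > 0, ∀ᵐ x ∂Θ.μ, ∀ ξ : E d,
    a * ‖ξ‖ ^ 2 ≤ inner ℝ (Λ x ξ) ξ ∧ inner ℝ (Λ x ξ) ξ ≤ b * ‖ξ‖ ^ 2

/-- `⟨Λ F, G⟩ = ∫_Θ Λ(x) F(x) · G(x) dx`. -/
def pairing {d : ℕ} {Θ : Domain d} (Λ : E d → E d →L[ℝ] E d) (F G : L2vec Θ) : ℝ :=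
  ∫ x, inner ℝ (Λ x (F x)) (G x) ∂Θ.μ

/-- `‖F‖_Λ = ⟨Λ F, F⟩^{1/2}`. -/
def normΛ {d : ℕ} {Θ : Domain d} (Λ : E d → E d →L[ℝ] E d) (F : L2vec Θ) : ℝ :=
  √(pairing Λ F F)

/-- The quadratic lower bound on `Ξ` which follows from coercivity of `ζ`. -/
lemma IsNonlinearity.sq_le_Xi {ζ : ℝ → ℝ} {K : ℝ≥0} (h : IsNonlinearity ζ K) :
    ∃ K₁ > 0, ∃ K₂ > 0, ∀ s : ℝ, s ^ 2 ≤ K₁ * Xi ζ s + K₂ := by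
  obtain ⟨c, hc, b, hb, hcb⟩ := h.coercive
  have hcont : Continuous ζ := h.lipschitz.continuous
  have key : ∀ s : ℝ, c * s ^ 2 / 2 - b * |s| ≤ Xi ζ s := by
    intro s
    unfold Xi
    rcases le_total 0 s with hs | hs
    · have h1 : ∫ t in (0 : ℝ)..s, (c * t - b) ≤ ∫ t in (0 : ℝ)..s, ζ t := by
        apply intervalIntegral.integral_mono_on hs
        · exact (by fun_prop : Continuous fun t : ℝ => c * t - b).intervalIntegrable _ _
        · exact hcont.intervalIntegrable _ _
        · intro t ht
          have h0 : 0 ≤ ζ t := by simpa [h.map_zero] using h.monotone ht.1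
          have := hcb t
          rwa [abs_of_nonneg ht.1, abs_of_nonneg h0] at this
      have h2 : ∫ t in (0 : ℝ)..s, (c * t - b) = c * s ^ 2 / 2 - b * s := by
        rw [intervalIntegral.integral_sub, intervalIntegral.integral_const_mul, integral_id,
          intervalIntegral.integral_const, smul_eq_mul]
        · ring
        all_goals exact Continuous.intervalIntegrable (by fun_prop) _ _
      rw [abs_of_nonneg hs]
      linarith
    · have h1 : ∫ t in s..(0 : ℝ), ζ t ≤ ∫ t in s..(0 : ℝ), (c * t + b) := by
        apply intervalIntegral.integral_mono_on hs
        · exact hcont.intervalIntegrable _ _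
        · exact (by fun_prop : Continuous fun t : ℝ => c * t + b).intervalIntegrable _ _
        · intro t ht
          have h0 : ζ t ≤ 0 := by simpa [h.map_zero] using h.monotone ht.2
          have := hcb t
          rw [abs_of_nonpos ht.2, abs_of_nonpos h0] at this
          linarith
      have h2 : ∫ t in s..(0 : ℝ), (c * t + b) = - (c * s ^ 2 / 2) - b * s := by
        rw [intervalIntegral.integral_add, intervalIntegral.integral_const_mul, integral_id,
          intervalIntegral.integral_const, smul_eq_mul]
        · ring
        all_goals exact Continuous.intervalIntegrable (by fun_prop) _ _
      rw [abs_of_nonpos hs, intervalIntegral.integral_symm]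
      linarith
  refine ⟨4 / c, by positivity, 4 * b ^ 2 / c ^ 2, by positivity, fun s => ?_⟩
  have h3 := key s
  have h4 : 0 ≤ (c * |s| - 2 * b) ^ 2 := sq_nonneg _
  have h5 : (4 / c) * (c * s ^ 2 / 2 - b * |s|) ≤ (4 / c) * Xi ζ s :=
    mul_le_mul_of_nonneg_left h3 (by positivity)
  have h6 : s ^ 2 = (4 / c) * (c * s ^ 2 / 2 - b * |s|) + 4 * b ^ 2 / c ^ 2
      - (c * |s| - 2 * b) ^ 2 / c ^ 2 := by
    rw [← sq_abs s]
    field_simp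
    ring
  have h7 : 0 ≤ (c * |s| - 2 * b) ^ 2 / c ^ 2 := by positivity
  linarith

/-- A measurable `u₀` with `Ξ(u₀) ∈ L¹(Θ)` belongs to `L²(Θ)`. -/
lemma IsNonlinearity.memLp {d : ℕ} {Θ : Domain d} {ζ : ℝ → ℝ} {K : ℝ≥0}
    (h : IsNonlinearity ζ K) {u₀ : E d → ℝ} (hm : AEStronglyMeasurable u₀ Θ.μ)
    (hi : Integrable (fun x => Xi ζ (u₀ x)) Θ.μ) : MemLp u₀ 2 Θ.μ := by
  obtain ⟨K₁, -, K₂, -, hK⟩ := h.sq_le_Xi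
  rw [memLp_two_iff_integrable_sq hm]
  refine Integrable.mono' ((hi.const_mul K₁).add (integrable_const K₂)) (hm.pow 2) ?_
  filter_upwards with x
  simpa using hK (u₀ x)

/-! ### Noise: Hilbert–Schmidt operators and the Wiener process -/

/-- The squared Hilbert–Schmidt norm `∑ₖ ‖A eₖ‖²` (possibly infinite) of an operator `A`; it does
not depend on the orthonormal basis `e`. -/
def hsNormSq {κ K H : Type*} [NormedAddCommGroup K] [InnerProductSpace ℝ K]
    [NormedAddCommGroup H] [InnerProductSpace ℝ H] (e : HilbertBasis κ ℝ K) (A : K →L[ℝ] H) :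
    ℝ≥0∞ := ∑' k, ‖A (e k)‖ₑ ^ 2

/-- Assumptions on `f`: it maps `L²(Θ)` continuously into the Hilbert–Schmidt operators from `K` to
`L²(Θ)`, and `‖f(ζ(w))‖²_HS ≤ C₂ ∫_Θ Ξ(w) dx + C₁`. -/
structure IsNoiseCoefficient {d : ℕ} {Θ : Domain d} {κ K : Type*} [NormedAddCommGroup K]
    [InnerProductSpace ℝ K] (e : HilbertBasis κ ℝ K) (ζ : ℝ → ℝ)
    (f : L2 Θ → K →L[ℝ] L2 Θ) : Prop where
  hilbertSchmidt : ∀ v, hsNormSq e (f v) ≠ ∞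
  continuous : ∀ v, Tendsto (fun w => hsNormSq e (f w - f v)) (𝓝 v) (𝓝 0)
  growth : ∃ C₁ > 0, ∃ C₂ > 0, ∀ w z : L2 Θ, Integrable (fun x => Xi ζ (w x)) Θ.μ →
    (z =ᵐ[Θ.μ] fun x => ζ (w x)) →
    hsNormSq e (f z) ≤ ENNReal.ofReal (C₂ * ∫ x, Xi ζ (w x) ∂Θ.μ + C₁)

/-- A standard real-valued Wiener process on the time interval `[0,T]`. -/
structure IsRealWiener {Ω : Type*} [MeasurableSpace Ω] {T : ℝ} (P : Measure Ω)
    (β : Icc (0 : ℝ) T → Ω → ℝ) : Prop where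
  measurable : ∀ t, Measurable (β t)
  start : ∀ t : Icc (0 : ℝ) T, (t : ℝ) = 0 → ∀ᵐ ω ∂P, β t ω = 0
  indep_increments : HasIndepIncrements β P
  law_increments : ∀ s t : Icc (0 : ℝ) T, s ≤ t →
    HasLaw (fun ω => β t ω - β s ω) (gaussianReal 0 (Real.toNNReal (t - s))) P
  continuous_paths : ∀ᵐ ω ∂P, Continuous fun t => β t ω

/-- `W` is, on `[0,T]`, an `𝓕`-adapted `K`-valued Wiener process `W(t) = ∑ₖ qₖ Wₖ(t) eₖ`, whose
covariance operator `Q` is given by `Q eₖ = qₖ² eₖ` and has finite trace `∑ₖ qₖ²`.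
The values of `W` at times outside `[0,T]` are irrelevant. -/
structure IsQWiener {Ω κ K : Type*} {mΩ : MeasurableSpace Ω} [NormedAddCommGroup K]
    [InnerProductSpace ℝ K] {T : ℝ} (P : Measure Ω) (𝓕 : Filtration (Icc (0 : ℝ) T) mΩ)
    (e : HilbertBasis κ ℝ K) (q : κ → ℝ) (W : ℝ → Ω → K) : Prop where
  trace_finite : Summable fun k => q k ^ 2
  adapted : ∀ t : Icc (0 : ℝ) T, StronglyMeasurable[𝓕 t] (W t)
  continuous_paths : ∀ᵐ ω ∂P, ContinuousOn (fun t => W t ω) (Icc 0 T)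
  expansion : ∃ β : κ → Icc (0 : ℝ) T → Ω → ℝ,
    (∀ k, IsRealWiener P (β k)) ∧
    (∀ k t, Measurable[𝓕 t] (β k t)) ∧
    iIndepFun (fun k ω t => β k t ω) P ∧
    ∀ t, ∀ᵐ ω ∂P, HasSum (fun k => (q k * β k t ω) • e k) (W t ω)

/-! ### Gradient discretisations -/

/-- A space-time gradient discretisation on `(0,T) × Θ` for homogeneous Dirichlet conditions, with
piecewise constant reconstruction. The space `X` of discrete unknowns is identified with `ι → ℝ`
through the basis attached to the reconstruction. The set `Y ⊆ L²(Θ)` is the set of initial data on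
which the interpolation operator is defined. The time points are `t^(n) = n δt`, `0 ≤ n ≤ N`, with
`δt = T / N`. The map `v ↦ ‖∇ v‖` is a norm on `X` iff the linear map `∇` is injective. -/
structure GradDisc {d : ℕ} (Θ : Domain d) (T : ℝ) (Y : Set (L2 Θ)) where
  ι : Type
  [fintype : Fintype ι]
  cell : ι → Set (E d)
  measurableSet_cell : ∀ i, MeasurableSet (cell i)
  cell_subset : ∀ i, cell i ⊆ Θ.carrier
  disjoint_cell : Pairwise fun i j => Disjoint (cell i) (cell j)
  grad : (ι → ℝ) →ₗ[ℝ] L2vec Θ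
  grad_injective : Function.Injective grad
  interp : Y → ι → ℝ
  N : ℕ
  N_pos : 0 < N

namespace GradDisc

attribute [instance] GradDisc.fintype

variable {d : ℕ} {Θ : Domain d} {T : ℝ} {Y : Set (L2 Θ)}

/-- The space of discrete unknowns. -/
abbrev X (D : GradDisc Θ T Y) : Type := D.ι → ℝ

/-- The time step. -/
def dt (D : GradDisc Θ T Y) : ℝ := T / D.N

/-- The time points `t^(n)`. -/
def time (D : GradDisc Θ T Y) (n : ℕ) : ℝ := n * D.dt

/-- The piecewise constant reconstruction `Π v = ∑ᵢ vᵢ 1_{Θᵢ}`, as a function on `ℝ^d` vanishing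
outside `Θ`. -/
def recon (D : GradDisc Θ T Y) (v : D.X) (x : E d) : ℝ :=
  ∑ i, v i * (D.cell i).indicator 1 x

lemma memLp_recon (D : GradDisc Θ T Y) (v : D.X) : MemLp (D.recon v) 2 Θ.μ := by
  unfold recon
  refine memLp_finsetSum _ fun i _ => ?_
  exact ((memLp_const (1 : ℝ)).indicator (D.measurableSet_cell i)).const_mul (v i)

/-- `Π v` as an element of `L²(Θ)`. -/
def reconL2 (D : GradDisc Θ T Y) (v : D.X) : L2 Θ := (D.memLp_recon v).toLp

/-- `g(v)` for `v ∈ X` and `g : ℝ → ℝ`: `g` is applied to the coordinates of `v`. -/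
def app (D : GradDisc Θ T Y) (g : ℝ → ℝ) (v : D.X) : D.X := fun i => g (v i)

/-- The piecewise constant in time function `∇ v : (0,T] → L²(Θ)^d` of a family `v^(0), …, v^(N)`:
it equals `∇ v^(n+1)` on `(t^(n), t^(n+1)]`, where `⌈t / δt⌉ = n + 1`. -/
def gradST (D : GradDisc Θ T Y) (v : ℕ → D.X) (t : ℝ) : L2vec Θ := D.grad (v ⌈t / D.dt⌉₊)

/-- The interpolation error `S_D(φ)` of `φ ∈ H¹₀(Θ)` with gradient `G`. -/
def S (D : GradDisc Θ T Y) (φ : L2 Θ) (G : L2vec Θ) : ℝ≥0∞ :=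
  ⨅ w : D.X, ‖D.reconL2 w - φ‖ₑ + ‖D.grad w - G‖ₑ

/-- The conformity defect `W_D(Φ)` of `Φ ∈ H^div(Θ)` with divergence `δ`. -/
def defect (D : GradDisc Θ T Y) (Φ : L2vec Θ) (δ : L2 Θ) : ℝ≥0∞ :=
  ⨆ (v : D.X) (_ : v ≠ 0), ‖inner ℝ (D.grad v) Φ + inner ℝ (D.reconL2 v) δ‖ₑ / ‖D.grad v‖ₑ

/-- The translation modulus `T_D(ξ)`. -/
def translation (D : GradDisc Θ T Y) (ξ : E d) : ℝ≥0∞ :=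
  ⨆ (v : D.X) (_ : v ≠ 0),
    eLpNorm (fun x => D.recon v (x + ξ) - D.recon v x) 2 volume / ‖D.grad v‖ₑ

end GradDisc

section Sequences

variable {d : ℕ} {Θ : Domain d} {T : ℝ} {Y : Set (L2 Θ)}

/-- Consistency of a sequence of gradient discretisations. -/
structure Consistent (ζ : ℝ → ℝ) (Λ : E d → E d →L[ℝ] E d) (D : ℕ → GradDisc Θ T Y) : Prop where
  space : ∀ (φ : L2 Θ) (G : L2vec Θ), IsH10 Θ φ G → Tendsto (fun m => (D m).S φ G) atTop (𝓝 0)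
  interp : ∀ φ : Y, Tendsto (fun m => (D m).reconL2 ((D m).interp φ)) atTop (𝓝 (φ : L2 Θ))
  interp_grad : ∀ φ : Y, ∃ M : ℝ, ∀ m,
    (D m).dt * normΛ Λ ((D m).grad ((D m).app ζ ((D m).interp φ))) ≤ M
  time_step : Tendsto (fun m => (D m).dt) atTop (𝓝 0)

/-- Limit-conformity of a sequence of gradient discretisations. -/
def LimitConforming (D : ℕ → GradDisc Θ T Y) : Prop :=
  ∀ (Φ : L2vec Θ) (δ : L2 Θ), IsHdiv Θ Φ δ → Tendsto (fun m => (D m).defect Φ δ) atTop (𝓝 0)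

/-- Compactness of a sequence of gradient discretisations. -/
def Compact (D : ℕ → GradDisc Θ T Y) : Prop :=
  Tendsto (fun ξ : E d => ⨆ m, (D m).translation ξ) (𝓝 0) (𝓝 0)

end Sequences

/-! ### The gradient scheme -/

section Scheme

variable {d : ℕ} {Θ : Domain d} {T : ℝ} {Y : Set (L2 Θ)}
  {K : Type*} [NormedAddCommGroup K] [InnerProductSpace ℝ K]
  {Ω : Type*}

/-- The `σ`-algebra `F^n_N = σ(W(t^(k)) : 0 ≤ k ≤ n)`. -/
abbrev GradDisc.sigmaW (D : GradDisc Θ T Y) (W : ℝ → Ω → K) (n : ℕ) : MeasurableSpace Ω :=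
  ⨆ (k : ℕ) (_ : k ≤ n), MeasurableSpace.comap (W (D.time k)) (borel K)

/-- `u = (u^(n))_{n = 0, …, N}` (the values for `n > N` are irrelevant) is a solution of the
gradient scheme with initial datum `u₀`. -/
structure IsSolution [MeasurableSpace Ω] (D : GradDisc Θ T Y) (ζ : ℝ → ℝ)
    (Λ : E d → E d →L[ℝ] E d) (f : L2 Θ → K →L[ℝ] L2 Θ) (u₀ : Y) (P : Measure Ω)
    (W : ℝ → Ω → K) (u : ℕ → Ω → D.X) : Prop where
  init : ∀ ω, u 0 ω = D.interp u₀
  adapted : ∀ n ≤ D.N, Measurable[D.sigmaW W n] (u n)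
  scheme : ∀ φ : D.X, ∀ᵐ ω ∂P, ∀ n < D.N,
    ∫ x, (D.recon (u (n + 1) ω) x - D.recon (u n ω) x) * D.recon φ x ∂Θ.μ
      + D.dt * pairing Λ (D.grad (D.app ζ (u (n + 1) ω))) (D.grad φ)
    = ∫ x, (f (D.reconL2 (D.app ζ (u n ω))) (W (D.time (n + 1)) ω - W (D.time n) ω) : L2 Θ) x
        * D.recon φ x ∂Θ.μ

/-- The quantity to be estimated, for a given realisation `u = (u^(n))_{n = 0, …, N}`:
`max_{0 ≤ n ≤ N} ∫_Θ Ξ(Π u^(n)) + ‖∇ζ(u)‖²_{L²((0,T) × Θ)}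
  + ∑_{n < N} ‖ζ(Π u^(n+1)) - ζ(Π u^(n))‖²_{L²(Θ)}`. -/
def GradDisc.energy (D : GradDisc Θ T Y) (ζ : ℝ → ℝ) (u : ℕ → D.X) : ℝ :=
  (⨆ n : Fin (D.N + 1), ∫ x, Xi ζ (D.recon (u n) x) ∂Θ.μ)
    + (∫ t in (0 : ℝ)..T, ‖D.gradST (fun n => D.app ζ (u n)) t‖ ^ 2)
    + ∑ n ∈ Finset.range D.N,
        ∫ x, (ζ (D.recon (u (n + 1)) x) - ζ (D.recon (u n) x)) ^ 2 ∂Θ.μ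

end Scheme

end

end Stefan

/-! Each step of the scheme is tested with ζ(u^(n+1)). As Ξ is convex with L-Lipschitz derivative ζ,
(a - b) ζ(a) ≥ Ξ(a) - Ξ(b) + (ζ(a) - ζ(b))²/(2L) (`Xi_sub_add_sq_le`). Summed over the cells, the
time difference therefore yields the increment of the energy x_n = ∫ Ξ(Π u^(n)) and a jump term,
while ellipticity yields the gradient. In the noise term, ζ(u^(n+1)) is replaced by ζ(u^(n)), which
leaves a martingale increment M_n; the remainder is absorbed by half of the jump term at the price L
y_n, where y_n = ‖f(Π ζ(u^(n))) ΔW‖². The outcome (`energy_step`) is x_(n+1) + ρ_n ≤ x_n + M_n + L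
y_n with dissipation ρ_n.

The increment ΔW is independent of the past and centred, with covariance eigenvalues δt q_k². Hence
E y_n is at most δt times an affine function of E x_n, and discrete Gronwall bounds E x_n by a
constant depending on N δt = T only.

For the maximum inside the expectation, Cauchy–Schwarz only gives M_n² ≤ c₀ x_n y_n, so the M_n are
merely known to be in L¹ and Doob's L² inequality does not apply to them. With Z_n = max_{k ≤ n} (1
+ x_k), which is known at time n, the increments D_n = M_n/√Z_n satisfy D_n² ≤ c₀ y_n, and Doob does
apply to ±∑ D_n. Summation by parts returns to ∑ M_n at the cost of a factor √Z_N, and Young's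
inequality absorbs the resulting Z_N/2 on the left (`exists_integrable_bound`).

The martingale property enters only as orthogonality of M_n to every weight known at time n.
Integrability of a solution is not assumed: it is derived by induction on n. -/

namespace Stefan

/-! ### Pathwise inequalities -/

/-- Pathwise form of Doob's `L²` maximal inequality. -/
lemma sq_partialSups_sum_le (D : ℕ → ℝ) (n : ℕ) :
    (partialSups (fun k => ∑ j ∈ Finset.range k, D j) n) ^ 2 ≤
      4 * ∑ k ∈ Finset.range n, D k ^ 2 + ∑ k ∈ Finset.range n,
        (8 * (∑ j ∈ Finset.range k, D j) -
          4 * partialSups (fun k => ∑ j ∈ Finset.range k, D j) k) * D k := by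
  set S : ℕ → ℝ := fun k => ∑ j ∈ Finset.range k, D j with hS
  set s : ℕ → ℝ := fun k => partialSups S k with hs
  have hS1 : ∀ k, S (k + 1) = S k + D k := fun k => Finset.sum_range_succ _ _
  have hs1 : ∀ k, s (k + 1) = max (s k) (S (k + 1)) := fun k => partialSups_add_one S k
  have h0 : s 0 = 0 := by simp [hs, hS]
  have hS0 : S 0 = 0 := by simp [hS]
  -- The running maximum s moves only at times when s = S, where the bound gains (S (k+1) - s k)²/2.
  -- Combining both parts of the claim leaves the perfect square (s - 2S)² ≥ 0, which accounts for
  -- the constants 4 and 8.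
  have key : ∀ k, s k ^ 2 / 2 ≤ s k * S k - ∑ j ∈ Finset.range k, s j * D j ∧
      S k ^ 2 = ∑ j ∈ Finset.range k, D j ^ 2 + 2 * ∑ j ∈ Finset.range k, S j * D j := by
    intro k
    induction k with
    | zero => simp [h0, hS0]
    | succ k ih =>
      obtain ⟨ih1, ih2⟩ := ih
      rw [Finset.sum_range_succ, Finset.sum_range_succ, Finset.sum_range_succ]
      constructor
      · have h2 := hS1 k
        rcases le_total (s k) (S (k + 1)) with h | h
        · rw [hs1, max_eq_right h]
          have : D k = S (k + 1) - S k := by linarith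
          rw [this]
          nlinarith [sq_nonneg (S (k + 1) - s k)]
        · rw [hs1, max_eq_left h, h2]
          linarith
      · rw [hS1]
        linarith
  obtain ⟨h1, h2⟩ := key n
  have h3 : ∑ k ∈ Finset.range n, (8 * S k - 4 * s k) * D k
      = 8 * ∑ k ∈ Finset.range n, S k * D k - 4 * ∑ k ∈ Finset.range n, s k * D k := by
    rw [Finset.mul_sum, Finset.mul_sum, ← Finset.sum_sub_distrib]
    exact Finset.sum_congr rfl fun k _ => by ring
  change s n ^ 2 ≤ 4 * ∑ k ∈ Finset.range n, D k ^ 2 +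
    ∑ k ∈ Finset.range n, (8 * S k - 4 * s k) * D k
  rw [h3]
  nlinarith [sq_nonneg (s n - 2 * S n)]

/-- Summation by parts against a nondecreasing weight. -/
lemma sum_mul_le_of_monotone {z D : ℕ → ℝ} {a b : ℝ} (hz : Monotone z) (hz0 : 0 ≤ z 0)
    (hb0 : 0 ≤ b) {n : ℕ} (ha : ∀ k ≤ n, ∑ j ∈ Finset.range k, D j ≤ a)
    (hb : ∀ k ≤ n, -b ≤ ∑ j ∈ Finset.range k, D j) :
    ∑ k ∈ Finset.range n, z k * D k ≤ z n * (a + b) := by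
  -- Abel summation: each increment of z multiplies minus a partial sum of D, which is at most b.
  have key : ∀ k ≤ n, ∑ j ∈ Finset.range k, z j * D j
      ≤ z k * (∑ j ∈ Finset.range k, D j) + b * (z k - z 0) := by
    intro k
    induction k with
    | zero => simp
    | succ k ih =>
      intro hk
      have h1 := ih (by omega)
      have h2 := hb (k + 1) hk
      have h3 := hz (Nat.le_succ k)
      rw [Finset.sum_range_succ] at h2 ⊢
      rw [Finset.sum_range_succ]
      simp only [Nat.succ_eq_add_one] at h3
      nlinarith [mul_nonneg (sub_nonneg.2 h3) (by linarith :
        0 ≤ ∑ j ∈ Finset.range k, D j + D k + b)]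
  have h1 := key n le_rfl
  have h2 := ha n le_rfl
  have h3 : 0 ≤ z n := hz0.trans (hz (Nat.zero_le n))
  nlinarith [mul_le_mul_of_nonneg_left h2 h3]

/-- Discrete Gronwall inequality with constant coefficients. -/
lemma discrete_gronwall {a : ℕ → ℝ} {N : ℕ} {p r : ℝ} (hp : 0 < p) (hr : 0 ≤ r)
    (ha0 : 0 ≤ a 0) (h : ∀ n < N, a (n + 1) ≤ a n + (p * a n + r)) :
    ∀ n ≤ N, a n ≤ (a 0 + r / p) * Real.exp (N * p) := by
  -- Shifting by r/p turns the affine recursion into a geometric one.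
  have h1 : ∀ n ≤ N, a n + r / p ≤ (a 0 + r / p) * (1 + p) ^ n := by
    intro n
    induction n with
    | zero => simp
    | succ n ih =>
      intro hn
      have h2 := ih (by omega)
      have h3 := h n (by omega)
      have h4 : a (n + 1) + r / p ≤ (1 + p) * (a n + r / p) := by
        have : (1 + p) * (a n + r / p) = a n + (p * a n + r) + r / p := by
          field_simp
          ring
        linarith
      calc _ ≤ (1 + p) * (a n + r / p) := h4
        _ ≤ (1 + p) * ((a 0 + r / p) * (1 + p) ^ n) := by gcongr
        _ = _ := by ring
  intro n hn
  have h2 : (1 + p) ^ n ≤ Real.exp (N * p) := by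
    calc (1 + p) ^ n ≤ Real.exp p ^ n := by
          gcongr
          linarith [Real.add_one_le_exp p]
      _ = Real.exp (n * p) := (Real.exp_nat_mul p n).symm
      _ ≤ _ := by gcongr
  have h3 : 0 ≤ r / p := by positivity
  have h4 := h1 n hn
  have h5 := mul_le_mul_of_nonneg_left h2 (add_nonneg ha0 h3)
  linarith

/-! ### Maximal estimates for discrete martingales -/

section Martingale

variable {Ω : Type*} {mΩ : MeasurableSpace Ω} {P : Measure Ω}

lemma measurable_partialSups_apply {m : ℕ → MeasurableSpace Ω} (hm : Monotone m) {N : ℕ}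
    {a : ℕ → Ω → ℝ} (ha : ∀ n ≤ N, Measurable[m n] (a n)) :
    ∀ n ≤ N, Measurable[m n] (fun ω => partialSups (fun k => a k ω) n) := by
  intro n
  induction n with
  | zero => simpa using ha 0
  | succ n ih =>
    intro hn
    simp only [partialSups_add_one]
    exact Measurable.sup ((ih (by omega)).mono (hm (Nat.le_succ n)) le_rfl) (ha _ hn)

lemma measurable_sum_range_apply {m : ℕ → MeasurableSpace Ω} (hm : Monotone m) {N : ℕ}
    {D : ℕ → Ω → ℝ} (hD : ∀ n < N, Measurable[m (n + 1)] (D n)) :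
    ∀ n ≤ N, Measurable[m n] (fun ω => ∑ j ∈ Finset.range n, D j ω) := by
  intro n
  induction n with
  | zero => intro _; simp
  | succ n ih =>
    intro hn
    simp only [Finset.sum_range_succ]
    exact Measurable.add ((ih (by omega)).mono (hm (Nat.le_succ n)) le_rfl) (hD n (by omega))

lemma memLp_partialSups_apply {N : ℕ} {a : ℕ → Ω → ℝ} {p : ℝ≥0∞} (ha : ∀ n ≤ N, MemLp (a n) p P) :
    ∀ n ≤ N, MemLp (fun ω => partialSups (fun k => a k ω) n) p P := by
  intro n
  induction n with
  | zero => simpa using ha 0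
  | succ n ih =>
    intro hn
    simp only [partialSups_add_one]
    exact MemLp.sup (ih (by omega)) (ha _ hn)

/-- Doob's `L²` maximal inequality for square integrable martingale increments `D`. -/
lemma integral_sq_partialSups_le {m : ℕ → MeasurableSpace Ω} (hm : Monotone m) {N : ℕ}
    {D : ℕ → Ω → ℝ} (hD : ∀ n < N, Measurable[m (n + 1)] (D n))
    (hD2 : ∀ n < N, MemLp (D n) 2 P)
    (hD0 : ∀ n < N, ∀ s : Ω → ℝ, Measurable[m n] s → Integrable (fun ω => s ω * D n ω) P →
      ∫ ω, s ω * D n ω ∂P = 0) :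
    Integrable (fun ω => (partialSups (fun k => ∑ j ∈ Finset.range k, D j ω) N) ^ 2) P ∧
    ∫ ω, (partialSups (fun k => ∑ j ∈ Finset.range k, D j ω) N) ^ 2 ∂P
      ≤ 4 * ∑ k ∈ Finset.range N, ∫ ω, D k ω ^ 2 ∂P := by
  have hS : ∀ n ≤ N, MemLp (fun ω => ∑ j ∈ Finset.range n, D j ω) 2 P := fun n hn =>
    memLp_finsetSum _ fun j hj => hD2 j (by have := Finset.mem_range.1 hj; omega)
  have hs := memLp_partialSups_apply hS
  have hSm := measurable_sum_range_apply hm hD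
  have hsm := measurable_partialSups_apply hm hSm
  -- The weights of the pathwise inequality are known at time k, so the sum against D has mean zero.
  set g : ℕ → Ω → ℝ := fun k ω => 8 * (∑ j ∈ Finset.range k, D j ω) -
      4 * partialSups (fun k => ∑ j ∈ Finset.range k, D j ω) k with hg
  have hgm : ∀ n ≤ N, Measurable[m n] (g n) := fun n hn =>
    Measurable.sub ((hSm n hn).const_mul 8) ((hsm n hn).const_mul 4)
  have hgL : ∀ n ≤ N, MemLp (g n) 2 P := fun n hn =>
    ((hS n hn).const_mul 8).sub ((hs n hn).const_mul 4)
  have hgi : ∀ n < N, Integrable (fun ω => g n ω * D n ω) P := fun n hn =>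
    (hgL n hn.le).integrable_mul (hD2 n hn)
  have hDi : ∀ n < N, Integrable (fun ω => D n ω ^ 2) P := fun n hn => (hD2 n hn).integrable_sq
  have hi1 : Integrable (fun ω => ∑ k ∈ Finset.range N, D k ω ^ 2) P :=
    integrable_finsetSum _ fun k hk => hDi k (Finset.mem_range.1 hk)
  have hi2 : Integrable (fun ω => ∑ k ∈ Finset.range N, g k ω * D k ω) P :=
    integrable_finsetSum _ fun k hk => hgi k (Finset.mem_range.1 hk)
  refine ⟨(hs N le_rfl).integrable_sq, ?_⟩
  calc ∫ ω, (partialSups (fun k => ∑ j ∈ Finset.range k, D j ω) N) ^ 2 ∂P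
      ≤ ∫ ω, (4 * ∑ k ∈ Finset.range N, D k ω ^ 2 + ∑ k ∈ Finset.range N, g k ω * D k ω) ∂P :=
        integral_mono (hs N le_rfl).integrable_sq ((hi1.const_mul 4).add hi2)
          fun ω => sq_partialSups_sum_le (fun k => D k ω) N
    _ = 4 * ∑ k ∈ Finset.range N, ∫ ω, D k ω ^ 2 ∂P := by
        rw [integral_add (hi1.const_mul 4) hi2, integral_const_mul,
          integral_finsetSum _ fun k hk => hDi k (Finset.mem_range.1 hk),
          integral_finsetSum _ fun k hk => hgi k (Finset.mem_range.1 hk),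
          Finset.sum_eq_zero (f := fun k => ∫ ω, g k ω * D k ω ∂P), add_zero]
        intro k hk
        have hk := Finset.mem_range.1 hk
        exact hD0 k hk _ (hgm k hk.le) (hgi k hk)

/-- Nonnegative real processes `x` (energy), `y` (quadratic noise), `ρ` (dissipation) and `M`
(martingale increments) related by a discrete energy inequality. -/
structure IsEnergyProcess (P : Measure Ω) (m : ℕ → MeasurableSpace Ω) (N : ℕ)
    (τ L c₀ c₁ c₂ X₀ : ℝ) (x y M ρ : ℕ → Ω → ℝ) : Prop where
  mono : Monotone m
  le : ∀ n ≤ N, m n ≤ mΩ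
  x_nonneg : ∀ n ω, 0 ≤ x n ω
  y_nonneg : ∀ n ω, 0 ≤ y n ω
  rho_nonneg : ∀ n ω, 0 ≤ ρ n ω
  x_meas : ∀ n ≤ N, Measurable[m n] (x n)
  M_meas : ∀ n < N, Measurable[m (n + 1)] (M n)
  M_sq_le : ∀ n < N, ∀ ω, M n ω ^ 2 ≤ c₀ * x n ω * y n ω
  step : ∀ n < N, ∀ᵐ ω ∂P, x (n + 1) ω + ρ n ω ≤ x n ω + M n ω + L * y n ω
  noise : ∀ n < N, Integrable (x n) P →
    Integrable (y n) P ∧ ∫ ω, y n ω ∂P ≤ τ * (c₂ * ∫ ω, x n ω ∂P + c₁)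
  orth : ∀ n < N, ∀ s : Ω → ℝ, Measurable[m n] s → Integrable (fun ω => s ω * M n ω) P →
    ∫ ω, s ω * M n ω ∂P = 0
  x_zero : ∀ ω, x 0 ω ≤ X₀

/-! ### Moment and maximal bounds from the discrete energy inequality -/

namespace IsEnergyProcess

variable {m : ℕ → MeasurableSpace Ω} {N : ℕ}
  {τ L c₀ c₁ c₂ X₀ : ℝ} {x y M ρ : ℕ → Ω → ℝ}

/-- By the arithmetic–geometric mean inequality, M² ≤ c₀ x y gives |M| ≤ (c₀ x + y)/2. -/
lemma integrable_M (h : IsEnergyProcess P m N τ L c₀ c₁ c₂ X₀ x y M ρ) (hc₀ : 0 ≤ c₀)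
    {n : ℕ} (hn : n < N) (hx : Integrable (x n) P) : Integrable (M n) P := by
  have hy := (h.noise n hn hx).1
  have hM : Measurable (M n) := (h.M_meas n hn).mono (h.le (n + 1) hn) le_rfl
  refine Integrable.mono' ((hx.const_mul (c₀ / 2)).add (hy.const_mul (1 / 2)))
    hM.aestronglyMeasurable (ae_of_all _ fun ω => ?_)
  have h1 := h.M_sq_le n hn ω
  have h2 := h.x_nonneg n ω
  have h3 := h.y_nonneg n ω
  simp only [Pi.add_apply, Real.norm_eq_abs]
  refine abs_le_of_sq_le_sq ?_ (by positivity)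
  nlinarith [sq_nonneg (c₀ * x n ω - y n ω)]

variable [IsProbabilityMeasure P]

/-- Integrability propagates in time: that of x n gives that of y n and M n, and the energy
inequality then dominates x (n+1). -/
lemma integrable_x (h : IsEnergyProcess P m N τ L c₀ c₁ c₂ X₀ x y M ρ) (hc₀ : 0 ≤ c₀) :
    ∀ n ≤ N, Integrable (x n) P := by
  intro n
  induction n with
  | zero =>
    intro _
    refine Integrable.mono' (integrable_const X₀)
      ((h.x_meas 0 (Nat.zero_le _)).mono (h.le 0 (Nat.zero_le _)) le_rfl).aestronglyMeasurable
      (ae_of_all _ fun ω => ?_)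
    rw [Real.norm_eq_abs, abs_of_nonneg (h.x_nonneg 0 ω)]
    exact h.x_zero ω
  | succ n ih =>
    intro hn
    have hx := ih (by omega)
    have hy := (h.noise n hn hx).1
    refine Integrable.mono' ((hx.add (h.integrable_M hc₀ hn hx)).add (hy.const_mul L))
      ((h.x_meas (n + 1) hn).mono (h.le _ hn) le_rfl).aestronglyMeasurable ?_
    filter_upwards [h.step n hn] with ω hω
    rw [Real.norm_eq_abs, abs_of_nonneg (h.x_nonneg _ ω)]
    have := h.rho_nonneg n ω
    simp only [Pi.add_apply]
    linarith

lemma integral_M (h : IsEnergyProcess P m N τ L c₀ c₁ c₂ X₀ x y M ρ) (hc₀ : 0 ≤ c₀)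
    {n : ℕ} (hn : n < N) : ∫ ω, M n ω ∂P = 0 := by
  have := h.orth n hn (fun _ => 1) measurable_const
    (by simpa using h.integrable_M hc₀ hn (h.integrable_x hc₀ n hn.le))
  simpa using this

/-- Gronwall on expectations, where the martingale term disappears. The step count enters only
through N τ, which makes the bound uniform in the discretisation. -/
lemma integral_x_le (h : IsEnergyProcess P m N τ L c₀ c₁ c₂ X₀ x y M ρ) (hc₀ : 0 ≤ c₀)
    (hτ : 0 < τ) (hL : 0 < L) (hc₁ : 0 ≤ c₁) (hc₂ : 0 < c₂) :
    ∀ n ≤ N, ∫ ω, x n ω ∂P ≤ (X₀ + c₁ / c₂) * Real.exp (N * τ * (L * c₂)) := by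
  intro n hn
  have h1 := discrete_gronwall (a := fun n => ∫ ω, x n ω ∂P) (N := N) (p := L * τ * c₂)
    (r := L * τ * c₁) (by positivity) (by positivity) (integral_nonneg (h.x_nonneg 0)) ?_ n hn
  · have h2 : ∫ ω, x 0 ω ∂P ≤ X₀ := by
      calc ∫ ω, x 0 ω ∂P ≤ ∫ _, X₀ ∂P :=
            integral_mono (h.integrable_x hc₀ 0 (Nat.zero_le _)) (integrable_const _) h.x_zero
        _ = X₀ := by simp
    have h3 : L * τ * c₁ / (L * τ * c₂) = c₁ / c₂ := by field_simp
    have h4 : (N : ℝ) * (L * τ * c₂) = N * τ * (L * c₂) := by ring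
    simp only [h3, h4] at h1
    refine h1.trans ?_
    gcongr
  · intro n hn
    have hx := h.integrable_x hc₀ n hn.le
    have hM := h.integrable_M hc₀ hn hx
    obtain ⟨hy, hy'⟩ := h.noise n hn hx
    have hxM : Integrable (fun ω => x n ω + M n ω) P := hx.add hM
    calc ∫ ω, x (n + 1) ω ∂P ≤ ∫ ω, (x n ω + M n ω + L * y n ω) ∂P := by
          refine integral_mono_ae (h.integrable_x hc₀ _ hn) (hxM.add (hy.const_mul L)) ?_
          filter_upwards [h.step n hn] with ω hω
          have := h.rho_nonneg n ω
          linarith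
      _ = ∫ ω, x n ω ∂P + L * ∫ ω, y n ω ∂P := by
          rw [integral_add hxM (hy.const_mul L), integral_add hx hM,
            h.integral_M hc₀ hn, integral_const_mul, add_zero]
      _ ≤ ∫ ω, x n ω ∂P + L * (τ * (c₂ * ∫ ω, x n ω ∂P + c₁)) := by gcongr
      _ = _ := by ring

/-- A single integrable random variable controls the maximum of the energy and the total
dissipation. -/
lemma exists_integrable_bound (h : IsEnergyProcess P m N τ L c₀ c₁ c₂ X₀ x y M ρ) (hc₀ : 0 ≤ c₀)
    (hτ : 0 < τ) (hL : 0 < L) (hc₁ : 0 ≤ c₁) (hc₂ : 0 < c₂) {Y : ℝ}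
    (hY : c₂ * ((X₀ + c₁ / c₂) * Real.exp (N * τ * (L * c₂))) + c₁ = Y) :
    ∃ Z : Ω → ℝ, Integrable Z P ∧
      ∫ ω, Z ω ∂P ≤ 3 * X₀ + 1 + (16 * c₀ + 3 * L) * (N * τ * Y) ∧
      ∀ᵐ ω ∂P, ∀ n ≤ N, x n ω + ∑ k ∈ Finset.range N, ρ k ω ≤ Z ω := by
  have hx := h.integrable_x hc₀
  have hy : ∀ n < N, Integrable (y n) P := fun n hn => (h.noise n hn (hx n hn.le)).1
  have hyY : ∀ n < N, ∫ ω, y n ω ∂P ≤ τ * Y := fun n hn => by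
    refine (h.noise n hn (hx n hn.le)).2.trans ?_
    rw [← hY]
    have := h.integral_x_le hc₀ hτ hL hc₁ hc₂ n hn.le
    gcongr
  have hMi : ∀ n < N, Integrable (M n) P := fun n hn => h.integrable_M hc₀ hn (hx n hn.le)
  -- The added 1 keeps the weight positive, so that dividing by its square root is harmless.
  set Zs : ℕ → Ω → ℝ := fun n ω => partialSups (fun k => 1 + x k ω) n with hZs
  have hZ1 : ∀ n ω, 1 + x n ω ≤ Zs n ω := fun n ω => le_partialSups (fun k => 1 + x k ω) n
  have hZpos : ∀ n ω, 0 < Zs n ω := fun n ω => by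
    have := hZ1 n ω
    have := h.x_nonneg n ω
    linarith
  have hZmono : ∀ ω, Monotone fun n => Zs n ω := fun ω =>
    (partialSups (fun k => 1 + x k ω)).monotone
  have hZm : ∀ n ≤ N, Measurable[m n] (Zs n) :=
    measurable_partialSups_apply h.mono fun n hn => (h.x_meas n hn).const_add 1
  have hsm : ∀ n ≤ N, Measurable[m n] (fun ω => (√(Zs n ω))⁻¹) := fun n hn =>
    ((hZm n hn).sqrt).inv
  set D : ℕ → Ω → ℝ := fun n ω => (√(Zs n ω))⁻¹ * M n ω with hD
  have hDm : ∀ n < N, Measurable[m (n + 1)] (D n) := fun n hn =>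
    Measurable.mul ((hsm n hn.le).mono (h.mono (Nat.le_succ n)) le_rfl) (h.M_meas n hn)
  have hD2 : ∀ n < N, ∀ ω, D n ω ^ 2 ≤ c₀ * y n ω := fun n hn ω => by
    have h1 := h.M_sq_le n hn ω
    have h2 := h.y_nonneg n ω
    have h3 : x n ω ≤ Zs n ω := by linarith [hZ1 n ω]
    simp only [hD, mul_pow, inv_pow, Real.sq_sqrt (hZpos n ω).le]
    rw [inv_mul_le_iff₀ (hZpos n ω)]
    calc M n ω ^ 2 ≤ c₀ * x n ω * y n ω := h1
      _ ≤ c₀ * Zs n ω * y n ω := by gcongr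
      _ = _ := by ring
  have hDL : ∀ n < N, MemLp (D n) 2 P := fun n hn => by
    have hDm' : AEStronglyMeasurable (D n) P :=
      ((hDm n hn).mono (h.le (n + 1) hn) le_rfl).aestronglyMeasurable
    rw [memLp_two_iff_integrable_sq hDm']
    refine Integrable.mono' ((hy n hn).const_mul c₀) (hDm'.pow 2) (ae_of_all _ fun ω => ?_)
    rw [Real.norm_eq_abs, abs_of_nonneg (sq_nonneg _)]
    exact hD2 n hn ω
  have hDi : ∀ n < N, ∫ ω, D n ω ^ 2 ∂P ≤ c₀ * (τ * Y) := fun n hn => by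
    calc ∫ ω, D n ω ^ 2 ∂P ≤ ∫ ω, c₀ * y n ω ∂P :=
          integral_mono (hDL n hn).integrable_sq ((hy n hn).const_mul c₀) (hD2 n hn)
      _ = c₀ * ∫ ω, y n ω ∂P := integral_const_mul _ _
      _ ≤ _ := mul_le_mul_of_nonneg_left (hyY n hn) hc₀
  have hD0 : ∀ n < N, ∀ s : Ω → ℝ, Measurable[m n] s → Integrable (fun ω => s ω * D n ω) P →
      ∫ ω, s ω * D n ω ∂P = 0 := fun n hn s hs hi => by
    have := h.orth n hn (fun ω => s ω * (√(Zs n ω))⁻¹) (hs.mul (hsm n hn.le))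
      (by simpa [hD, mul_assoc] using hi)
    simpa [hD, mul_assoc] using this
  -- Both D and -D are needed: summation by parts uses upper and lower bounds on the partial sums.
  obtain ⟨hpi, hp⟩ := integral_sq_partialSups_le h.mono hDm hDL hD0
  obtain ⟨hni, hn⟩ := integral_sq_partialSups_le (D := fun n ω => -D n ω) h.mono
    (fun n hn => (hDm n hn).neg) (fun n hn => (hDL n hn).neg)
    (fun n hn s hs hi => by
      simp only [mul_neg, integral_neg, neg_eq_zero] at hi ⊢
      exact hD0 n hn s hs (by simpa using hi.neg))
  set sp : Ω → ℝ := fun ω => partialSups (fun k => ∑ j ∈ Finset.range k, D j ω) N with hsp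
  set sn : Ω → ℝ := fun ω => partialSups (fun k => ∑ j ∈ Finset.range k, -D j ω) N with hsn
  have hsum : ∑ k ∈ Finset.range N, ∫ ω, D k ω ^ 2 ∂P ≤ N * (c₀ * (τ * Y)) := by
    calc _ ≤ ∑ _k ∈ Finset.range N, c₀ * (τ * Y) :=
          Finset.sum_le_sum fun k hk => hDi k (Finset.mem_range.1 hk)
      _ = _ := by simp
  simp only [neg_sq] at hn
  have hSy : Integrable (fun ω => ∑ k ∈ Finset.range N, y k ω) P :=
    integrable_finsetSum _ fun k hk => hy k (Finset.mem_range.1 hk)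
  have hSM : Integrable (fun ω => ∑ k ∈ Finset.range N, M k ω) P :=
    integrable_finsetSum _ fun k hk => hMi k (Finset.mem_range.1 hk)
  have hSyY : ∫ ω, ∑ k ∈ Finset.range N, y k ω ∂P ≤ N * (τ * Y) := by
    rw [integral_finsetSum _ fun k hk => hy k (Finset.mem_range.1 hk)]
    calc _ ≤ ∑ _k ∈ Finset.range N, τ * Y :=
          Finset.sum_le_sum fun k hk => hyY k (Finset.mem_range.1 hk)
      _ = _ := by simp
  have hSM0 : ∫ ω, ∑ k ∈ Finset.range N, M k ω ∂P = 0 := by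
    rw [integral_finsetSum _ fun k hk => hMi k (Finset.mem_range.1 hk)]
    exact Finset.sum_eq_zero fun k hk => h.integral_M hc₀ (Finset.mem_range.1 hk)
  have hi2 : Integrable (fun ω => 3 * X₀ + 1 + 2 * sp ω ^ 2) P :=
    (integrable_const _).add (hpi.const_mul 2)
  have hi3 : Integrable (fun ω => 3 * X₀ + 1 + 2 * sp ω ^ 2 + 2 * sn ω ^ 2) P :=
    hi2.add (hni.const_mul 2)
  have hi4 : Integrable (fun ω => 3 * X₀ + 1 + 2 * sp ω ^ 2 + 2 * sn ω ^ 2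
      + ∑ k ∈ Finset.range N, M k ω) P := hi3.add hSM
  -- Absorbing √Z_N (sp + sn) ≤ Z_N/2 + sp² + sn² gives Z_N ≤ 2 + 2X₀ + 2sp² + 2sn² + 2L ∑ y. The
  -- cumulated energy inequality bounds ∑ ρ by X₀ + ∑ M + L ∑ y. This bound is the sum of the two,
  -- less 1 because Z_N dominates 1 + x. The term ∑ M has mean zero.
  refine ⟨fun ω => 3 * X₀ + 1 + 2 * sp ω ^ 2 + 2 * sn ω ^ 2 + ∑ k ∈ Finset.range N, M k ω
    + 3 * L * ∑ k ∈ Finset.range N, y k ω, ?_, ?_, ?_⟩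
  · exact hi4.add (hSy.const_mul (3 * L))
  · rw [integral_add hi4 (hSy.const_mul (3 * L)), integral_add hi3 hSM,
      integral_add hi2 (hni.const_mul 2), integral_add (integrable_const _) (hpi.const_mul 2),
      integral_const_mul, integral_const_mul, integral_const_mul, hSM0, integral_const]
    simp only [probReal_univ, one_smul]
    have h5 := mul_le_mul_of_nonneg_left hSyY (by positivity : 0 ≤ 3 * L)
    linarith
  · have hall : ∀ᵐ ω ∂P, ∀ n, n < N → x (n + 1) ω + ρ n ω ≤ x n ω + M n ω + L * y n ω :=
      ae_all_iff.2 fun n => by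
        by_cases hn : n < N
        · filter_upwards [h.step n hn] with ω hω _ using hω
        · exact ae_of_all _ fun ω h => absurd h hn
    filter_upwards [hall] with ω hω
    have hcum : ∀ n ≤ N, x n ω + ∑ k ∈ Finset.range n, ρ k ω ≤
        X₀ + ∑ k ∈ Finset.range n, M k ω + L * ∑ k ∈ Finset.range n, y k ω := by
      intro n
      induction n with
      | zero => simpa using h.x_zero ω
      | succ n ih =>
        intro hn
        have h1 := ih (by omega)
        have h2 := hω n hn
        simp only [Finset.sum_range_succ]
        linarith
    have hspn : ∀ k ≤ N, ∑ j ∈ Finset.range k, D j ω ≤ sp ω := fun k hk =>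
      le_partialSups_of_le (fun k => ∑ j ∈ Finset.range k, D j ω) hk
    have hsnn : ∀ k ≤ N, -sn ω ≤ ∑ j ∈ Finset.range k, D j ω := fun k hk => by
      have := le_partialSups_of_le (fun k => ∑ j ∈ Finset.range k, -D j ω) hk
      simp only [Finset.sum_neg_distrib] at this
      simp only [hsn, Finset.sum_neg_distrib]
      linarith
    have hsp0 : 0 ≤ sp ω := by simpa using hspn 0 (Nat.zero_le _)
    have hsn0 : 0 ≤ sn ω := by simpa using hsnn 0 (Nat.zero_le _)
    have hM : ∀ n ≤ N, ∑ k ∈ Finset.range n, M k ω ≤ √(Zs N ω) * (sp ω + sn ω) := by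
      intro n hn
      have h1 := sum_mul_le_of_monotone (z := fun k => √(Zs k ω)) (D := fun k => D k ω)
        (a := sp ω) (b := sn ω) (fun i j hij => Real.sqrt_le_sqrt (hZmono ω hij))
        (Real.sqrt_nonneg _) hsn0 (n := n) (fun k hk => hspn k (hk.trans hn))
        (fun k hk => hsnn k (hk.trans hn))
      have h2 : ∀ k, √(Zs k ω) * D k ω = M k ω := fun k => by
        have := (Real.sqrt_pos.2 (hZpos k ω)).ne'
        simp only [hD]
        field_simp
      simp only [h2] at h1
      exact h1.trans (mul_le_mul_of_nonneg_right (Real.sqrt_le_sqrt (hZmono ω hn))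
        (add_nonneg hsp0 hsn0))
    have hyN : ∀ n ≤ N, ∑ k ∈ Finset.range n, y k ω ≤ ∑ k ∈ Finset.range N, y k ω := fun n hn =>
      Finset.sum_le_sum_of_subset_of_nonneg (Finset.range_mono hn)
        fun k _ _ => h.y_nonneg k ω
    have hxle : ∀ n ≤ N, 1 + x n ω ≤ 1 + X₀ + √(Zs N ω) * (sp ω + sn ω)
        + L * ∑ k ∈ Finset.range N, y k ω := fun n hn => by
      have h1 := hcum n hn
      have h2 := hM n hn
      have h3 := mul_le_mul_of_nonneg_left (hyN n hn) hL.le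
      have h4 : 0 ≤ ∑ k ∈ Finset.range n, ρ k ω :=
        Finset.sum_nonneg fun k _ => h.rho_nonneg k ω
      linarith
    have hZle : Zs N ω ≤ 1 + X₀ + √(Zs N ω) * (sp ω + sn ω)
        + L * ∑ k ∈ Finset.range N, y k ω := partialSups_le _ _ _ fun k hk => hxle k hk
    have hsq := Real.sq_sqrt (hZpos N ω).le
    intro n hn
    have h1 : 1 + x n ω ≤ Zs N ω := le_partialSups_of_le (fun k => 1 + x k ω) hn
    have h2 := hcum N le_rfl
    have h3 := h.x_nonneg N ω
    nlinarith [sq_nonneg (√(Zs N ω) - (sp ω + sn ω)), sq_nonneg (sp ω - sn ω)]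

end IsEnergyProcess

end Martingale

/-! ### Centred noise with diagonal covariance -/

section Noise

variable {κ K H Ω : Type*} [NormedAddCommGroup K] [InnerProductSpace ℝ K] [MeasurableSpace K]
  [NormedAddCommGroup H] [InnerProductSpace ℝ H]

/-- `ν` is centred and square integrable, with covariance operator `e k ↦ σ k • e k`, as seen
through coordinates in the basis `e`. -/
structure HasDiagCov (ν : Measure K) (e : HilbertBasis κ ℝ K) (σ : κ → ℝ) : Prop where
  coord_memLp : ∀ i, MemLp (fun w => inner ℝ (e i) w) 2 ν
  mean : ∀ i, ∫ w, inner ℝ (e i) w ∂ν = 0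
  var : ∀ i, ∫ w, inner ℝ (e i) w ^ 2 ∂ν = σ i
  cov : ∀ i j, i ≠ j → ∫ w, inner ℝ (e i) w * inner ℝ (e j) w ∂ν = 0
  summable : Summable σ

namespace HasDiagCov

variable {ν : Measure K} {e : HilbertBasis κ ℝ K} {σ : κ → ℝ}

lemma nonneg (h : HasDiagCov ν e σ) (i : κ) : 0 ≤ σ i := by
  rw [← h.var i]
  exact integral_nonneg fun _ => sq_nonneg _

/-- Expanding the square, the off-diagonal terms vanish because distinct coordinates are
uncorrelated. -/
lemma lintegral_sq_norm_sum (h : HasDiagCov ν e σ) (A : K →L[ℝ] H) (F : Finset κ) :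
    ∫⁻ w, ‖∑ k ∈ F, inner ℝ (e k) w • A (e k)‖ₑ ^ 2 ∂ν
      = ∑ k ∈ F, ENNReal.ofReal (σ k) * ‖A (e k)‖ₑ ^ 2 := by
  classical
  have h1 : ∀ w, ‖∑ k ∈ F, inner ℝ (e k) w • A (e k)‖ ^ 2 = ∑ i ∈ F, ∑ j ∈ F,
      (inner ℝ (e i) w * inner ℝ (e j) w) * inner ℝ (A (e i)) (A (e j)) := fun w => by
    rw [← real_inner_self_eq_norm_sq, sum_inner]
    refine Finset.sum_congr rfl fun i _ => ?_
    rw [inner_sum]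
    refine Finset.sum_congr rfl fun j _ => ?_
    rw [real_inner_smul_left, real_inner_smul_right]
    ring
  have hi : ∀ i j, Integrable (fun w => (inner ℝ (e i) w * inner ℝ (e j) w) *
      inner ℝ (A (e i)) (A (e j))) ν := fun i j =>
    ((h.coord_memLp i).integrable_mul (h.coord_memLp j)).mul_const _
  have hint : Integrable (fun w => ‖∑ k ∈ F, inner ℝ (e k) w • A (e k)‖ ^ 2) ν := by
    simp only [h1]
    exact integrable_finsetSum _ fun i _ => integrable_finsetSum _ fun j _ => hi i j
  have h2 : ∫ w, ‖∑ k ∈ F, inner ℝ (e k) w • A (e k)‖ ^ 2 ∂ν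
      = ∑ k ∈ F, σ k * ‖A (e k)‖ ^ 2 := by
    simp only [h1]
    rw [integral_finsetSum _ fun i _ => integrable_finsetSum _ fun j _ => hi i j]
    refine Finset.sum_congr rfl fun i hiF => ?_
    rw [integral_finsetSum _ fun j _ => hi i j]
    simp only [integral_mul_const]
    rw [Finset.sum_eq_single_of_mem i hiF]
    · simp only [← sq, h.var i, real_inner_self_eq_norm_sq]
    · intro j _ hj
      rw [h.cov i j hj.symm, zero_mul]
  calc ∫⁻ w, ‖∑ k ∈ F, inner ℝ (e k) w • A (e k)‖ₑ ^ 2 ∂ν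
      = ∫⁻ w, ENNReal.ofReal (‖∑ k ∈ F, inner ℝ (e k) w • A (e k)‖ ^ 2) ∂ν := by
        simp_rw [ENNReal.ofReal_pow (norm_nonneg _), ofReal_norm]
    _ = ENNReal.ofReal (∑ k ∈ F, σ k * ‖A (e k)‖ ^ 2) := by
        rw [← ofReal_integral_eq_lintegral_ofReal hint (ae_of_all _ fun _ => sq_nonneg _), h2]
    _ = _ := by
        rw [ENNReal.ofReal_sum_of_nonneg fun k _ => mul_nonneg (h.nonneg k) (sq_nonneg _)]
        simp_rw [ENNReal.ofReal_mul (h.nonneg _), ENNReal.ofReal_pow (norm_nonneg _), ofReal_norm]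

variable [BorelSpace K]

/-- Fatou along finite sets exhausting the basis; countability supplies a sequence of such sets. -/
lemma lintegral_sq_norm_le [Countable κ] (h : HasDiagCov ν e σ) (A : K →L[ℝ] H) :
    ∫⁻ w, ‖A w‖ₑ ^ 2 ∂ν ≤ ∑' k, ENNReal.ofReal (σ k) * ‖A (e k)‖ₑ ^ 2 := by
  obtain ⟨F, hF⟩ := Filter.exists_seq_tendsto (atTop : Filter (Finset κ))
  have hlim : ∀ w, Tendsto (fun n => ‖∑ k ∈ F n, inner ℝ (e k) w • A (e k)‖ₑ ^ 2) atTop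
      (𝓝 (‖A w‖ₑ ^ 2)) := fun w => by
    have h1 : HasSum (fun k => inner ℝ (e k) w • A (e k)) (A w) := by
      have := (e.hasSum_repr w).mapL A
      simpa [e.repr_apply_apply] using this
    exact ((ENNReal.continuous_pow 2).tendsto _).comp (h1.enorm.comp hF)
  calc ∫⁻ w, ‖A w‖ₑ ^ 2 ∂ν
      = ∫⁻ w, liminf (fun n => ‖∑ k ∈ F n, inner ℝ (e k) w • A (e k)‖ₑ ^ 2) atTop ∂ν :=
        lintegral_congr fun w => (hlim w).liminf_eq.symm
    _ ≤ liminf (fun n => ∫⁻ w, ‖∑ k ∈ F n, inner ℝ (e k) w • A (e k)‖ₑ ^ 2 ∂ν) atTop := by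
        refine lintegral_liminf_le fun n => Continuous.measurable ?_
        fun_prop
    _ ≤ _ := by
        simp only [h.lintegral_sq_norm_sum]
        refine liminf_le_of_le (by isBoundedDefault) fun b hb => ?_
        obtain ⟨n, hn⟩ := hb.exists
        exact hn.trans (ENNReal.sum_le_tsum _)

/-- Each variance is at most the trace, which separates noise from operator. -/
lemma lintegral_sq_norm_le_hsNormSq [Countable κ] (h : HasDiagCov ν e σ) (A : K →L[ℝ] H) :
    ∫⁻ w, ‖A w‖ₑ ^ 2 ∂ν ≤ ENNReal.ofReal (∑' k, σ k) * hsNormSq e A := by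
  refine (h.lintegral_sq_norm_le A).trans ?_
  rw [hsNormSq, ← ENNReal.tsum_mul_left]
  refine ENNReal.tsum_le_tsum fun k => ?_
  gcongr
  exact h.summable.le_tsum k fun j _ => h.nonneg j

variable [SecondCountableTopology K]

lemma memLp_id [Countable κ] (h : HasDiagCov ν e σ) : MemLp (fun w : K => w) 2 ν := by
  refine ⟨aestronglyMeasurable_id, ?_⟩
  rw [eLpNorm_lt_top_iff_lintegral_rpow_enorm_lt_top (by simp) (by simp)]
  have h1 := h.lintegral_sq_norm_le (ContinuousLinearMap.id ℝ K)
  simp only [ENNReal.toReal_ofNat, ENNReal.rpow_ofNat]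
  refine h1.trans_lt ?_
  have h2 : ∀ k, ‖(e k : K)‖ₑ = 1 := fun k => by
    rw [← ofReal_norm, e.orthonormal.1 k, ENNReal.ofReal_one]
  simp only [ContinuousLinearMap.coe_id', id_eq, h2, one_pow, mul_one]
  rw [← ENNReal.ofReal_tsum_of_nonneg h.nonneg h.summable]
  exact ENNReal.ofReal_lt_top

lemma integral_clm_eq_zero [Countable κ] [CompleteSpace K] [IsProbabilityMeasure ν]
    (h : HasDiagCov ν e σ) (l : K →L[ℝ] ℝ) : ∫ w, l w ∂ν = 0 := by
  have hi : Integrable (fun w : K => w) ν := h.memLp_id.integrable (by norm_num)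
  rw [l.integral_comp_comm hi]
  have h1 : ∫ w, w ∂ν = 0 := by
    refine e.repr.injective ?_
    rw [map_zero]
    ext k
    rw [e.repr_apply_apply]
    have := (innerSL ℝ (e k)).integral_comp_comm hi
    simp only [innerSL_apply_apply] at this
    rw [← this, h.mean]
    rfl
  rw [h1, map_zero]

end HasDiagCov

variable {mΩ : MeasurableSpace Ω} {P : Measure Ω} [IsProbabilityMeasure P]
  {e : HilbertBasis κ ℝ K} {σ : κ → ℝ} [BorelSpace K]
  [Countable κ] {S : Type*} [MeasurableSpace S] {U : Ω → S} {V : Ω → K}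

/-- A functional that is linear in an independent centred noise has mean zero. -/
lemma integral_linear_indep_eq_zero [SecondCountableTopology K] [CompleteSpace K] (hU : Measurable U) (hV : Measurable V)
    (hUV : IndepFun U V P) (hcov : HasDiagCov (P.map V) e σ) {l : S → K →L[ℝ] ℝ}
    (hl : Measurable fun p : S × K => l p.1 p.2) (hi : Integrable (fun ω => l (U ω) (V ω)) P) :
    ∫ ω, l (U ω) (V ω) ∂P = 0 := by
  have : IsProbabilityMeasure (P.map V) := Measure.isProbabilityMeasure_map hV.aemeasurable
  have : IsProbabilityMeasure (P.map U) := Measure.isProbabilityMeasure_map hU.aemeasurable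
  have hmap := hUV.map_prod_eq_prod_map_map hU.aemeasurable hV.aemeasurable
  have h1 : ∫ ω, l (U ω) (V ω) ∂P
      = ∫ p, l p.1 p.2 ∂((P.map U).prod (P.map V)) := by
    rw [← hmap, integral_map (hU.prodMk hV).aemeasurable hl.aestronglyMeasurable]
  have h2 : Integrable (fun p : S × K => l p.1 p.2) ((P.map U).prod (P.map V)) := by
    rw [← hmap, integrable_map_measure hl.aestronglyMeasurable (hU.prodMk hV).aemeasurable]
    exact hi
  rw [h1, integral_prod _ h2]
  simp [hcov.integral_clm_eq_zero]

/-- Itô's inequality for one time step. -/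
lemma lintegral_sq_norm_indep_le (hU : Measurable U) (hV : Measurable V)
    (hUV : IndepFun U V P) (hcov : HasDiagCov (P.map V) e σ) {A : S → K →L[ℝ] H}
    (hA : Measurable fun p : S × K => ‖A p.1 p.2‖ₑ) {g : S → ℝ≥0∞} (hg : Measurable g)
    (hAg : ∀ s, hsNormSq e (A s) ≤ g s) :
    ∫⁻ ω, ‖A (U ω) (V ω)‖ₑ ^ 2 ∂P ≤ ENNReal.ofReal (∑' k, σ k) * ∫⁻ ω, g (U ω) ∂P := by
  have : IsProbabilityMeasure (P.map V) := Measure.isProbabilityMeasure_map hV.aemeasurable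
  have : IsProbabilityMeasure (P.map U) := Measure.isProbabilityMeasure_map hU.aemeasurable
  have hmap := hUV.map_prod_eq_prod_map_map hU.aemeasurable hV.aemeasurable
  have hA2 : Measurable fun p : S × K => ‖A p.1 p.2‖ₑ ^ 2 := hA.pow_const 2
  have h1 : ∫⁻ ω, ‖A (U ω) (V ω)‖ₑ ^ 2 ∂P
      = ∫⁻ p, ‖A p.1 p.2‖ₑ ^ 2 ∂((P.map U).prod (P.map V)) := by
    rw [← hmap, lintegral_map hA2 (hU.prodMk hV)]
  have h2 := lintegral_const_mul (μ := P) (ENNReal.ofReal (∑' k, σ k)) (hg.comp hU)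
  simp only [Function.comp_apply] at h2
  rw [h1, lintegral_prod _ hA2.aemeasurable, ← h2,
    lintegral_map (f := fun x => ∫⁻ y, ‖A x y‖ₑ ^ 2 ∂(P.map V)) hA2.lintegral_prod_right' hU]
  refine lintegral_mono fun ω => (hcov.lintegral_sq_norm_le_hsNormSq (A (U ω))).trans ?_
  gcongr
  exact hAg _

end Noise

/-! ### Increments of the Wiener process -/

namespace IsQWiener

variable {Ω κ K : Type*} {mΩ : MeasurableSpace Ω} [NormedAddCommGroup K] [InnerProductSpace ℝ K]
  {T : ℝ} {P : Measure Ω} {𝓕 : Filtration (Icc (0 : ℝ) T) mΩ}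
  {e : HilbertBasis κ ℝ K} {q : κ → ℝ} {W : ℝ → Ω → K} {t : ℕ → Icc (0 : ℝ) T}

/-- The coordinates of the increments of `W` along a time grid form one independent family of
centred Gaussian variables. -/
lemma exists_increments [Countable κ] (h : IsQWiener P 𝓕 e q W) (ht : Monotone t)
    (ht0 : (t 0 : ℝ) = 0) :
    ∃ X : κ → ℕ → Ω → ℝ, (∀ k j, Measurable (X k j)) ∧
      iIndepFun (fun (p : κ × ℕ) => X p.1 p.2) P ∧
      (∀ k j, HasLaw (X k j) (gaussianReal 0 (Real.toNNReal (t (j + 1) - t j))) P) ∧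
      ∀ j, ∀ᵐ ω ∂P, ∀ k, inner ℝ (e k) (W (t j) ω) = q k * ∑ i ∈ Finset.range j, X k i ω := by
  obtain ⟨β, hβ, -, hind, hexp⟩ := h.expansion
  have hm : ∀ k s, Measurable (β k s) := fun k => (hβ k).measurable
  refine ⟨fun k j ω => β k (t (j + 1)) ω - β k (t j) ω, fun k j => (hm k _).sub (hm k _), ?_,
    fun k j => (hβ k).law_increments _ _ (ht (Nat.le_succ j)), fun j => ?_⟩
  -- Independence between the Wiener processes combines with independence of increments within each
  -- one.
  · refine iIndepFun_uncurry' (fun k j => (hm k _).sub (hm k _)) ?_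
      fun k => (hβ k).indep_increments.nat ht
    exact hind.comp (fun _ b j => b (t (j + 1)) - b (t j)) fun _ =>
      measurable_pi_lambda _ fun j => (measurable_pi_apply _).sub (measurable_pi_apply _)
  · have h0 : ∀ᵐ ω ∂P, ∀ k, β k (t 0) ω = 0 := ae_all_iff.2 fun k => (hβ k).start _ ht0
    filter_upwards [h0, hexp (t j)] with ω h0 hω k
    rw [Finset.sum_range_sub (fun i => β k (t i) ω), h0, sub_zero, ← e.repr_apply_apply]
    have h2 := hω.mapL (innerSL ℝ (e k))
    have h3 : HasSum (fun i => innerSL ℝ (e k) ((q i * β i (t j) ω) • e i))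
        (innerSL ℝ (e k) ((q k * β k (t j) ω) • e k)) := by
      refine hasSum_single k fun i hi => ?_
      simp [e.orthonormal.2 hi.symm]
    have h4 := h2.unique h3
    simpa [inner_smul_right, e.repr_apply_apply, real_inner_self_eq_norm_sq, e.orthonormal.1 k]
      using h4

variable [MeasurableSpace K] [BorelSpace K]

lemma measurable_apply (h : IsQWiener P 𝓕 e q W) (s : Icc (0 : ℝ) T) : Measurable (W s) :=
  ((h.adapted s).mono (𝓕.le s)).measurable

variable [SecondCountableTopology K]

/-- A continuous injection between Polish spaces is a Borel embedding. Thus a `K`-valued variable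
generates the same σ-algebra as its coordinates. -/
lemma measurableEmbedding_coord [CompleteSpace K] [Countable κ] (e : HilbertBasis κ ℝ K) :
    MeasurableEmbedding fun (w : K) (k : κ) => (inner ℝ (e k) w : ℝ) := by
  refine Continuous.measurableEmbedding (by fun_prop) fun a b hab => e.repr.injective ?_
  ext k
  simpa [e.repr_apply_apply] using congrFun hab k

/-- The increments of `W` are independent of the past. -/
lemma indep_increment [CompleteSpace K] [Countable κ] (h : IsQWiener P 𝓕 e q W)
    (ht : Monotone t) (ht0 : (t 0 : ℝ) = 0) (n : ℕ) :
    Indep (⨆ (j : ℕ) (_ : j ≤ n), MeasurableSpace.comap (W (t j)) inferInstance)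
      (MeasurableSpace.comap (fun ω => W (t (n + 1)) ω - W (t n) ω) inferInstance) P := by
  obtain ⟨X, hXm, hXi, -, hX⟩ := h.exists_increments ht ht0
  -- Splitting the scalar increments by time index into j < n and j = n gives independence of past
  -- and present. The coordinates of W agree with functions of these increments only almost surely,
  -- so independence is transferred between functions first and read off as σ-algebras afterwards.
  have hind := indep_iSup_of_disjoint (fun p : κ × ℕ => (hXm p.1 p.2).comap_le) hXi.iIndep
    (S := {p | p.2 < n}) (T := {p | p.2 = n})
    (Set.disjoint_left.2 fun p (h1 : p.2 < n) (h2 : p.2 = n) => by omega)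
  set 𝒜 : MeasurableSpace Ω := ⨆ p ∈ {p : κ × ℕ | p.2 < n},
    MeasurableSpace.comap (X p.1 p.2) inferInstance with h𝒜
  set ℬ : MeasurableSpace Ω := ⨆ p ∈ {p : κ × ℕ | p.2 = n},
    MeasurableSpace.comap (X p.1 p.2) inferInstance with hℬ
  have hXA : ∀ k j, j < n → Measurable[𝒜] (X k j) := fun k j hj =>
    (comap_measurable (X k j)).mono
      (le_iSup₂_of_le (f := fun (p : κ × ℕ) (_ : p ∈ {p : κ × ℕ | p.2 < n}) =>
        MeasurableSpace.comap (X p.1 p.2) inferInstance) (k, j) hj le_rfl) le_rfl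
  have hXB : ∀ k, Measurable[ℬ] (X k n) := fun k =>
    (comap_measurable (X k n)).mono
      (le_iSup₂_of_le (f := fun (p : κ × ℕ) (_ : p ∈ {p : κ × ℕ | p.2 = n}) =>
        MeasurableSpace.comap (X p.1 p.2) inferInstance) (k, n) rfl le_rfl) le_rfl
  set Φ : K → κ → ℝ := fun w k => inner ℝ (e k) w with hΦ
  have hΦm : MeasurableEmbedding Φ := measurableEmbedding_coord e
  have hA : Measurable[𝒜] fun ω (j : Fin (n + 1)) (k : κ) =>
      q k * ∑ i ∈ Finset.range (j : ℕ), X k i ω := by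
    refine @measurable_pi_lambda _ _ _ 𝒜 _ _ fun j => @measurable_pi_lambda _ _ _ 𝒜 _ _ fun k => ?_
    refine Measurable.const_mul ?_ _
    refine Finset.measurable_fun_sum _ fun i hi => hXA k i ?_
    have := Finset.mem_range.1 hi
    omega
  have hB : Measurable[ℬ] fun ω (k : κ) => q k * X k n ω :=
    @measurable_pi_lambda _ _ _ ℬ _ _ fun k => (hXB k).const_mul _
  have h1 : IndepFun (fun ω (j : Fin (n + 1)) (k : κ) =>
      q k * ∑ i ∈ Finset.range (j : ℕ), X k i ω) (fun ω (k : κ) => q k * X k n ω) P :=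
    indep_of_indep_of_le_left (indep_of_indep_of_le_right hind hB.comap_le) hA.comap_le
  have h2 : IndepFun (fun ω (j : Fin (n + 1)) => Φ (W (t j) ω))
      (fun ω => Φ (W (t (n + 1)) ω - W (t n) ω)) P := by
    refine h1.congr ?_ ?_
    · have : ∀ᵐ ω ∂P, ∀ j : Fin (n + 1), ∀ k, inner ℝ (e k) (W (t j) ω)
          = q k * ∑ i ∈ Finset.range (j : ℕ), X k i ω := ae_all_iff.2 fun j => hX j
      filter_upwards [this] with ω hω
      funext j k
      exact (hω j k).symm
    · filter_upwards [hX n, hX (n + 1)] with ω h1 h2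
      funext k
      simp only [hΦ, inner_sub_right, h1, h2, Finset.sum_range_succ]
      ring
  refine indep_of_indep_of_le_left (indep_of_indep_of_le_right h2 ?_) ?_
  · change _ ≤ MeasurableSpace.comap (Φ ∘ fun ω => W (t (n + 1)) ω - W (t n) ω) _
    rw [← MeasurableSpace.comap_comp, hΦm.comap_eq]
  · refine iSup₂_le fun j hj => ?_
    have h3 : MeasurableSpace.comap (W (t j)) inferInstance
        = MeasurableSpace.comap (Φ ∘ W (t j)) inferInstance := by
      rw [← MeasurableSpace.comap_comp, hΦm.comap_eq]
    rw [h3]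
    have h4 : Φ ∘ W (t j) = (fun z : Fin (n + 1) → κ → ℝ => z ⟨j, by omega⟩) ∘
        fun ω (j : Fin (n + 1)) => Φ (W (t j) ω) := rfl
    rw [h4, ← MeasurableSpace.comap_comp]
    exact MeasurableSpace.comap_mono (measurable_pi_apply _).comap_le

/-- Almost surely the k-th coordinate of the increment is q k times a centred Gaussian whose
variance is the step length, and these Gaussians are independent in k. -/
lemma hasDiagCov_increment [Countable κ] (h : IsQWiener P 𝓕 e q W)
    (ht : Monotone t) (ht0 : (t 0 : ℝ) = 0) (n : ℕ) :
    HasDiagCov (P.map fun ω => W (t (n + 1)) ω - W (t n) ω) e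
      fun k => ((t (n + 1) : ℝ) - t n) * q k ^ 2 := by
  obtain ⟨X, hXm, hXi, hXl, hX⟩ := h.exists_increments ht ht0
  have hV : Measurable fun ω => W (t (n + 1)) ω - W (t n) ω :=
    (h.measurable_apply _).sub (h.measurable_apply _)
  have hae : ∀ᵐ ω ∂P, ∀ k, inner ℝ (e k) (W (t (n + 1)) ω - W (t n) ω) = q k * X k n ω := by
    filter_upwards [hX n, hX (n + 1)] with ω h1 h2 k
    rw [inner_sub_right, h1, h2, Finset.sum_range_succ]
    ring
  have hτ : 0 ≤ (t (n + 1) : ℝ) - t n := sub_nonneg.2 (ht (Nat.le_succ n))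
  have hc : ∀ k, Measurable fun w : K => (inner ℝ (e k) w : ℝ) := fun k =>
    Continuous.measurable (by fun_prop)
  have hXL : ∀ k, MemLp (X k n) 2 P := fun k => by
    have := memLp_id_gaussianReal (μ := 0) (v := Real.toNNReal (t (n + 1) - t n)) 2
    rw [← (hXl k n).map_eq] at this
    exact (memLp_map_measure_iff aestronglyMeasurable_id (hXm k n).aemeasurable).1 this
  have hmean : ∀ k, ∫ ω, X k n ω ∂P = 0 := fun k => by
    rw [(hXl k n).integral_eq, integral_id_gaussianReal]
  refine ⟨fun k => ?_, fun k => ?_, fun k => ?_, fun k l hkl => ?_, h.trace_finite.mul_left _⟩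
  · rw [memLp_map_measure_iff (hc k).aestronglyMeasurable hV.aemeasurable]
    refine ((hXL k).const_mul (q k)).ae_eq ?_
    filter_upwards [hae] with ω hω
    exact (hω k).symm
  · rw [integral_map hV.aemeasurable (hc k).aestronglyMeasurable,
      integral_congr_ae (g := fun ω => q k * X k n ω) (by filter_upwards [hae] with ω hω using hω k),
      integral_const_mul, hmean, mul_zero]
  · rw [integral_map hV.aemeasurable ((hc k).pow_const 2).aestronglyMeasurable,
      integral_congr_ae (g := fun ω => q k ^ 2 * X k n ω ^ 2)
        (by filter_upwards [hae] with ω hω; simp only [hω k, mul_pow]),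
      integral_const_mul]
    have h1 := (hXl k n).variance_eq
    rw [variance_id_gaussianReal, variance_of_integral_eq_zero (hXm k n).aemeasurable (hmean k)]
      at h1
    rw [h1, Real.coe_toNNReal _ hτ, mul_comm]
  · have hm2 : Measurable fun w : K => (inner ℝ (e k) w * inner ℝ (e l) w : ℝ) := (hc k).mul (hc l)
    rw [integral_map hV.aemeasurable hm2.aestronglyMeasurable,
      integral_congr_ae (g := fun ω => (q k * q l) * (X k n ω * X l n ω))
        (by filter_upwards [hae] with ω hω; simp only [hω k, hω l]; ring),
      integral_const_mul]
    have h1 : IndepFun (X k n) (X l n) P :=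
      hXi.indepFun (i := (k, n)) (j := (l, n)) (by simpa using hkl)
    rw [h1.integral_fun_mul_eq_mul_integral (hXm k n).aestronglyMeasurable
      (hXm l n).aestronglyMeasurable, hmean, zero_mul, mul_zero]

end IsQWiener

/-! ### The nonlinearity -/

namespace IsNonlinearity

variable {ζ : ℝ → ℝ} {K : ℝ≥0}

lemma Xi_sub (h : IsNonlinearity ζ K) (a b : ℝ) : Xi ζ b - Xi ζ a = ∫ s in a..b, ζ s :=
  intervalIntegral.integral_interval_sub_left
    (h.lipschitz.continuous.intervalIntegrable _ _) (h.lipschitz.continuous.intervalIntegrable _ _)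

lemma mul_sub_le_Xi_sub (h : IsNonlinearity ζ K) (a b : ℝ) :
    ζ a * (b - a) ≤ Xi ζ b - Xi ζ a := by
  have hc : ∀ x y, IntervalIntegrable ζ volume x y :=
    h.lipschitz.continuous.intervalIntegrable
  rw [h.Xi_sub]
  rcases le_total a b with hab | hab
  · have := intervalIntegral.integral_mono_on hab intervalIntegrable_const (hc a b)
      (f := fun _ => ζ a) fun s hs => h.monotone hs.1
    simpa [mul_comm] using this
  · have := intervalIntegral.integral_mono_on hab (hc b a) intervalIntegrable_const
      (g := fun _ => ζ a) fun s hs => h.monotone hs.2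
    rw [intervalIntegral.integral_symm]
    simp only [intervalIntegral.integral_const, smul_eq_mul] at this
    linarith

/-- Integrates the linear bound on ζ around a that the Lipschitz condition provides. -/
lemma Xi_sub_le (h : IsNonlinearity ζ K) {L : ℝ} (hL : K ≤ L) (a b : ℝ) :
    Xi ζ b - Xi ζ a ≤ ζ a * (b - a) + L * (b - a) ^ 2 / 2 := by
  have hc : ∀ x y, IntervalIntegrable ζ volume x y :=
    h.lipschitz.continuous.intervalIntegrable
  have hl : ∀ s, |ζ s - ζ a| ≤ L * |s - a| := fun s =>
    (by simpa [Real.dist_eq] using h.lipschitz.dist_le_mul s a : |ζ s - ζ a| ≤ K * |s - a|).trans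
      (by gcongr)
  have hg : ∀ x y, IntervalIntegrable (fun s => ζ a + L * (s - a)) volume x y := fun x y =>
    Continuous.intervalIntegrable (by fun_prop) _ _
  have hint : ∀ x y, ∫ s in x..y, (ζ a + L * (s - a))
      = ζ a * (y - x) + L * ((y ^ 2 - x ^ 2) / 2 - (y - x) * a) := fun x y => by
    rw [intervalIntegral.integral_add (by simp) (Continuous.intervalIntegrable (by fun_prop) _ _),
      intervalIntegral.integral_const_mul, intervalIntegral.integral_sub (by simp) (by simp)]
    simp
    ring
  rw [h.Xi_sub]
  rcases le_total a b with hab | hab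
  · have := intervalIntegral.integral_mono_on hab (hc a b) (hg a b) fun s hs => by
      have h1 := abs_le.1 (hl s)
      rw [abs_of_nonneg (sub_nonneg.2 hs.1)] at h1
      linarith
    rw [hint] at this
    linarith
  · have := intervalIntegral.integral_mono_on hab (hg b a) (hc b a) fun s hs => by
      have h1 := abs_le.1 (hl s)
      rw [abs_of_nonpos (sub_nonpos.2 hs.2)] at h1
      linarith
    rw [hint] at this
    rw [intervalIntegral.integral_symm]
    linarith

lemma Xi_zero (ζ : ℝ → ℝ) : Xi ζ 0 = 0 := intervalIntegral.integral_same

lemma Xi_nonneg (h : IsNonlinearity ζ K) (z : ℝ) : 0 ≤ Xi ζ z := by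
  simpa [h.map_zero, Xi_zero] using h.mul_sub_le_Xi_sub 0 z

lemma Xi_le (h : IsNonlinearity ζ K) {L : ℝ} (hL : K ≤ L) (z : ℝ) : Xi ζ z ≤ L * z ^ 2 / 2 := by
  simpa [h.map_zero, Xi_zero] using h.Xi_sub_le hL 0 z

/-- Strengthened convexity of `Ξ`, whose derivative `ζ` is `L`-Lipschitz. -/
lemma Xi_sub_add_sq_le (h : IsNonlinearity ζ K) {L : ℝ} (hL : K ≤ L) (hL0 : 0 < L) (a b : ℝ) :
    Xi ζ a - Xi ζ b + (ζ a - ζ b) ^ 2 / (2 * L) ≤ (a - b) * ζ a := by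
  -- Compare, at one point, the tangent to Ξ at a with the quadratic upper bound from b. The point b
  -- + (ζ a - ζ b)/L is the one where their difference is extremal.
  have h1 := h.mul_sub_le_Xi_sub a (b + (ζ a - ζ b) / L)
  have h2 := h.Xi_sub_le hL b (b + (ζ a - ζ b) / L)
  have h3 : ζ a * (b + (ζ a - ζ b) / L - a)
      = ζ a * (b - a) + (ζ a * (ζ a - ζ b)) / L := by ring
  have h4 : ζ b * (b + (ζ a - ζ b) / L - b) + L * (b + (ζ a - ζ b) / L - b) ^ 2 / 2
      = (ζ b * (ζ a - ζ b)) / L + (ζ a - ζ b) ^ 2 / (2 * L) := by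
    field_simp
    ring
  have h5 : (ζ a - ζ b) ^ 2 / (2 * L) = (ζ a * (ζ a - ζ b)) / L - (ζ b * (ζ a - ζ b)) / L
      - (ζ a - ζ b) ^ 2 / (2 * L) := by
    field_simp
    ring
  linarith

lemma sq_le (h : IsNonlinearity ζ K) {L : ℝ} (hL : K ≤ L) (hL0 : 0 < L) (z : ℝ) :
    ζ z ^ 2 ≤ 2 * L * Xi ζ z := by
  have := h.Xi_sub_add_sq_le hL hL0 0 z
  rw [h.map_zero, Xi_zero, mul_zero, zero_sub, zero_sub, neg_sq] at this
  have h2 : ζ z ^ 2 / (2 * L) ≤ Xi ζ z := by linarith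
  rw [div_le_iff₀ (by positivity)] at h2
  linarith

lemma continuous_Xi (h : IsNonlinearity ζ K) : Continuous (Xi ζ) :=
  intervalIntegral.continuous_primitive
    (fun a b => h.lipschitz.continuous.intervalIntegrable a b) 0

end IsNonlinearity

/-! ### The diffusion tensor -/

section Pairing

variable {d : ℕ} {Θ : Domain d} {Λ : E d → E d →L[ℝ] E d}

/-- Only the quadratic form of Λ is bounded, so the bilinear form is estimated by polarisation,
using symmetry and the parallelogram law. -/
lemma IsDiffusionTensor.integrable_pairing (h : IsDiffusionTensor Θ Λ) (F G : L2vec Θ) :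
    Integrable (fun x => inner ℝ (Λ x (F x)) (G x)) Θ.μ := by
  obtain ⟨a, ha, b, hb, hab⟩ := h.elliptic_bounded
  have hF := Lp.memLp F
  have hG := Lp.memLp G
  have hm : AEStronglyMeasurable (fun x => inner ℝ (Λ x (F x)) (G x)) Θ.μ :=
    ((isBoundedBilinearMap_apply.continuous.comp_aestronglyMeasurable
      (h.measurable.prodMk hF.1)) : AEStronglyMeasurable (fun x => Λ x (F x)) Θ.μ).inner hG.1
  refine Integrable.mono' ((hF.integrable_norm_pow (by norm_num)).add
    (hG.integrable_norm_pow (by norm_num)) |>.const_mul (b / 2)) hm ?_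
  filter_upwards [hab, h.symmetric] with x hx hs
  have h1 := hx (F x + G x)
  have h2 := hx (F x - G x)
  have hsym := (hs (G x) (F x)).trans (real_inner_comm _ _)
  have hp : b * ‖F x + G x‖ ^ 2 + b * ‖F x - G x‖ ^ 2 = 2 * b * (‖F x‖ ^ 2 + ‖G x‖ ^ 2) := by
    have := parallelogram_law_with_norm ℝ (F x) (G x)
    linear_combination b * this
  simp only [map_add, map_sub, inner_add_left, inner_add_right, inner_sub_left,
    inner_sub_right] at h1 h2
  have e1 : 0 ≤ a * ‖F x + G x‖ ^ 2 := by positivity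
  have e2 : 0 ≤ a * ‖F x - G x‖ ^ 2 := by positivity
  have e3 : 0 ≤ b * ‖F x + G x‖ ^ 2 := by positivity
  have e4 : 0 ≤ b * ‖F x - G x‖ ^ 2 := by positivity
  simp only [Pi.add_apply, Real.norm_eq_abs]
  rw [abs_le]
  constructor <;> linarith

lemma IsDiffusionTensor.pairing_add (h : IsDiffusionTensor Θ Λ) (F G G' : L2vec Θ) :
    pairing Λ F (G + G') = pairing Λ F G + pairing Λ F G' := by
  unfold pairing
  rw [← integral_add (h.integrable_pairing F G) (h.integrable_pairing F G')]
  refine integral_congr_ae ?_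
  filter_upwards [Lp.coeFn_add G G'] with x hx
  rw [hx, Pi.add_apply, inner_add_right]

lemma pairing_smul (c : ℝ) (F G : L2vec Θ) :
    pairing Λ F (c • G) = c * pairing Λ F G := by
  unfold pairing
  rw [← integral_const_mul]
  refine integral_congr_ae ?_
  filter_upwards [Lp.coeFn_smul c G] with x hx
  rw [hx, Pi.smul_apply, real_inner_smul_right]

lemma IsDiffusionTensor.le_pairing_self (h : IsDiffusionTensor Θ Λ) {a : ℝ}
    (ha : ∀ᵐ x ∂Θ.μ, ∀ ξ : E d, a * ‖ξ‖ ^ 2 ≤ inner ℝ (Λ x ξ) ξ) (F : L2vec Θ) :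
    a * ‖F‖ ^ 2 ≤ pairing Λ F F := by
  have h1 : ‖F‖ ^ 2 = ∫ x, ‖F x‖ ^ 2 ∂Θ.μ := by
    rw [← real_inner_self_eq_norm_sq, L2.inner_def]
    simp
  rw [h1, ← integral_const_mul]
  refine integral_mono_ae ?_ (h.integrable_pairing F F) ?_
  · exact ((Lp.memLp F).integrable_norm_pow (by norm_num)).const_mul a
  · filter_upwards [ha] with x hx using hx (F x)

end Pairing

/-! ### Hilbert–Schmidt operators -/

section HilbertSchmidt

variable {κ K H : Type*} [NormedAddCommGroup K] [InnerProductSpace ℝ K]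
  [NormedAddCommGroup H] [InnerProductSpace ℝ H]

/-- Expand in the basis, then apply Cauchy–Schwarz and Bessel to partial sums. -/
lemma enorm_sq_le_hsNormSq (e : HilbertBasis κ ℝ K) (A : K →L[ℝ] H) :
    ‖A‖ₑ ^ 2 ≤ hsNormSq e A := by
  by_cases hA : hsNormSq e A = ∞
  · simp [hA]
  set S := (hsNormSq e A).toReal with hS
  have hF : ∀ F : Finset κ, ∑ k ∈ F, ‖A (e k)‖ ^ 2 ≤ S := fun F => by
    have h1 : ∑ k ∈ F, ‖A (e k)‖ₑ ^ 2 ≤ hsNormSq e A := ENNReal.sum_le_tsum F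
    have h2 := ENNReal.toReal_mono hA h1
    rw [ENNReal.toReal_sum fun k _ => by simp] at h2
    simpa using h2
  have hb : ‖A‖ ≤ √S := by
    refine A.opNorm_le_bound (Real.sqrt_nonneg _) fun w => ?_
    have h1 : HasSum (fun k => inner ℝ (e k) w • A (e k)) (A w) := by
      have := (e.hasSum_repr w).mapL A
      simpa [e.repr_apply_apply] using this
    refine le_of_tendsto h1.norm (Eventually.of_forall fun F => ?_)
    calc ‖∑ k ∈ F, inner ℝ (e k) w • A (e k)‖
        ≤ ∑ k ∈ F, ‖inner ℝ (e k) w‖ * ‖A (e k)‖ :=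
          (norm_sum_le _ _).trans_eq (by simp only [norm_smul])
      _ ≤ √(∑ k ∈ F, ‖inner ℝ (e k) w‖ ^ 2) * √(∑ k ∈ F, ‖A (e k)‖ ^ 2) :=
          Real.sum_mul_le_sqrt_mul_sqrt _ _ _
      _ ≤ √(‖w‖ ^ 2) * √S := by
          gcongr
          · exact e.orthonormal.sum_inner_products_le w
          · exact hF F
      _ = √S * ‖w‖ := by rw [Real.sqrt_sq (norm_nonneg _), mul_comm]
  calc ‖A‖ₑ ^ 2 = ENNReal.ofReal (‖A‖ ^ 2) := by
        rw [ENNReal.ofReal_pow (norm_nonneg _), ofReal_norm]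
    _ ≤ ENNReal.ofReal S := by
        refine ENNReal.ofReal_le_ofReal ?_
        rw [← Real.sq_sqrt (show 0 ≤ S from ENNReal.toReal_nonneg)]
        gcongr
    _ = hsNormSq e A := ENNReal.ofReal_toReal hA

/-- Hilbert–Schmidt continuity dominates operator-norm continuity; this yields joint measurability
of the noise in the iterate and the increment. -/
lemma IsNoiseCoefficient.continuous_opNorm {d : ℕ} {Θ : Domain d} {e : HilbertBasis κ ℝ K}
    {ζ : ℝ → ℝ} {f : L2 Θ → K →L[ℝ] L2 Θ} (hf : IsNoiseCoefficient e ζ f) : Continuous f := by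
  rw [continuous_iff_continuousAt]
  intro v
  rw [ContinuousAt, tendsto_iff_edist_tendsto_0]
  have h1 : Tendsto (fun w => ‖f w - f v‖ₑ ^ 2) (𝓝 v) (𝓝 0) :=
    tendsto_of_tendsto_of_tendsto_of_le_of_le tendsto_const_nhds (hf.continuous v)
      (fun _ => zero_le) fun w => enorm_sq_le_hsNormSq e _
  have h2 := ((ENNReal.continuous_rpow_const (y := (1 / 2 : ℝ))).tendsto 0).comp h1
  rw [ENNReal.zero_rpow_of_pos (by norm_num)] at h2
  refine h2.congr fun w => ?_
  simp only [Function.comp_apply]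
  rw [← ENNReal.rpow_natCast, ← ENNReal.rpow_mul, edist_eq_enorm_sub]
  norm_num

end HilbertSchmidt

/-! ### Gradient discretisations in coordinates -/

namespace GradDisc

variable {d : ℕ} {Θ : Domain d} {T : ℝ} {Y : Set (L2 Θ)} (D : GradDisc Θ T Y)

/-- The Lebesgue measure of a cell. -/
noncomputable def mass (i : D.ι) : ℝ := Θ.μ.real (D.cell i)

lemma mass_nonneg (i : D.ι) : 0 ≤ D.mass i := measureReal_nonneg

lemma recon_of_mem {i : D.ι} {x : E d} (hx : x ∈ D.cell i) (v : D.X) : D.recon v x = v i := by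
  unfold recon
  rw [Finset.sum_eq_single i]
  · simp [hx]
  · intro j _ hj
    have : x ∉ D.cell j := fun h => Set.disjoint_left.1 (D.disjoint_cell hj) h hx
    simp [this]
  · simp

lemma recon_of_forall_notMem {x : E d} (hx : ∀ i, x ∉ D.cell i) (v : D.X) : D.recon v x = 0 := by
  simp [recon, hx]

lemma recon_app {g : ℝ → ℝ} (hg : g 0 = 0) (v : D.X) (x : E d) :
    D.recon (D.app g v) x = g (D.recon v x) := by
  by_cases hx : ∃ i, x ∈ D.cell i
  · obtain ⟨i, hi⟩ := hx
    simp [D.recon_of_mem hi, app]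
  · push Not at hx
    simp [D.recon_of_forall_notMem hx, hg]

/-- Disjointness of the cells makes reconstruction multiplicative, so integrals of products reduce
to sums weighted by `mass`. -/
lemma recon_mul (v w : D.X) (x : E d) :
    D.recon v x * D.recon w x = D.recon (fun i => v i * w i) x := by
  by_cases hx : ∃ i, x ∈ D.cell i
  · obtain ⟨i, hi⟩ := hx
    simp [D.recon_of_mem hi]
  · push Not at hx
    simp [D.recon_of_forall_notMem hx]

lemma recon_add (v w : D.X) : D.recon (v + w) = D.recon v + D.recon w := by
  funext x
  simp [recon, add_mul, Finset.sum_add_distrib]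

lemma recon_smul (c : ℝ) (v : D.X) : D.recon (c • v) = c • D.recon v := by
  funext x
  simp [recon, mul_assoc, Finset.mul_sum]

lemma recon_sub (v w : D.X) (x : E d) : D.recon v x - D.recon w x = D.recon (v - w) x := by
  simp [recon, sub_mul, Finset.sum_sub_distrib]

lemma integral_recon (v : D.X) : ∫ x, D.recon v x ∂Θ.μ = ∑ i, v i * D.mass i := by
  unfold recon
  have hi : ∀ i, Integrable (fun x => v i * (D.cell i).indicator 1 x) Θ.μ := fun i =>
    Integrable.const_mul ((integrable_const (1 : ℝ)).indicator (D.measurableSet_cell i)) (v i)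
  rw [integral_finsetSum _ fun i _ => hi i]
  refine Finset.sum_congr rfl fun i _ => ?_
  rw [integral_const_mul, integral_indicator_one (D.measurableSet_cell i), mass]

lemma coeFn_reconL2 (v : D.X) : D.reconL2 v =ᵐ[Θ.μ] D.recon v := MemLp.coeFn_toLp _

lemma inner_reconL2 (F : L2 Θ) (φ : D.X) :
    inner ℝ F (D.reconL2 φ) = ∫ x, F x * D.recon φ x ∂Θ.μ := by
  rw [L2.inner_def]
  refine integral_congr_ae ?_
  filter_upwards [D.coeFn_reconL2 φ] with x hx
  simp [hx, mul_comm]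

lemma norm_sq_reconL2 (v : D.X) : ‖D.reconL2 v‖ ^ 2 = ∑ i, v i ^ 2 * D.mass i := by
  rw [← real_inner_self_eq_norm_sq, inner_reconL2]
  have h1 : ∫ x, D.reconL2 v x * D.recon v x ∂Θ.μ = ∫ x, D.recon (fun i => v i * v i) x ∂Θ.μ := by
    refine integral_congr_ae ?_
    filter_upwards [D.coeFn_reconL2 v] with x hx
    rw [hx, recon_mul]
  rw [h1, integral_recon]
  simp only [sq]

/-- The reconstruction as a linear map into `L²(Θ)`. -/
noncomputable def reconLM : D.X →ₗ[ℝ] L2 Θ where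
  toFun := D.reconL2
  map_add' v w := by
    refine Lp.ext ?_
    filter_upwards [D.coeFn_reconL2 (v + w), D.coeFn_reconL2 v, D.coeFn_reconL2 w,
      Lp.coeFn_add (D.reconL2 v) (D.reconL2 w)] with x h1 h2 h3 h4
    rw [h1, h4, Pi.add_apply, h2, h3, recon_add, Pi.add_apply]
  map_smul' c v := by
    refine Lp.ext ?_
    filter_upwards [D.coeFn_reconL2 (c • v), D.coeFn_reconL2 v,
      Lp.coeFn_smul c (D.reconL2 v)] with x h1 h2 h3
    rw [h1, RingHom.id_apply, h3, Pi.smul_apply, h2, recon_smul, Pi.smul_apply]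

lemma continuous_reconL2 : Continuous D.reconL2 :=
  D.reconLM.continuous_of_finiteDimensional

lemma continuous_grad : Continuous D.grad := D.grad.continuous_of_finiteDimensional

lemma continuous_app {g : ℝ → ℝ} (hg : Continuous g) : Continuous (D.app g) :=
  continuous_pi fun i => hg.comp (continuous_apply i)

/-- `∫_Θ Ξ(Π v) dx`. -/
noncomputable def xi (ζ : ℝ → ℝ) (v : D.X) : ℝ := ∑ i, Xi ζ (v i) * D.mass i

/-- `‖ζ(Π v) - ζ(Π w)‖²`. -/
noncomputable def jump (ζ : ℝ → ℝ) (v w : D.X) : ℝ := ∑ i, (ζ (v i) - ζ (w i)) ^ 2 * D.mass i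

lemma integral_Xi_recon (ζ : ℝ → ℝ) (v : D.X) :
    ∫ x, Xi ζ (D.recon v x) ∂Θ.μ = D.xi ζ v := by
  simp_rw [← D.recon_app (IsNonlinearity.Xi_zero ζ) v, integral_recon]
  rfl

lemma integral_sq_recon_sub {ζ : ℝ → ℝ} (hζ : ζ 0 = 0) (v w : D.X) :
    ∫ x, (ζ (D.recon v x) - ζ (D.recon w x)) ^ 2 ∂Θ.μ = D.jump ζ v w := by
  simp_rw [← D.recon_app hζ, recon_sub, sq, recon_mul, integral_recon, jump, sq]
  rfl

lemma jump_nonneg (ζ : ℝ → ℝ) (v w : D.X) : 0 ≤ D.jump ζ v w :=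
  Finset.sum_nonneg fun i _ => mul_nonneg (sq_nonneg _) (D.mass_nonneg i)

lemma dt_pos (hT : 0 < T) : 0 < D.dt := div_pos hT (Nat.cast_pos.2 D.N_pos)

lemma N_mul_dt : D.N * D.dt = T := by
  have : (D.N : ℝ) ≠ 0 := Nat.cast_ne_zero.2 D.N_pos.ne'
  unfold dt
  field_simp

lemma integral_gradST (hT : 0 < T) (v : ℕ → D.X) :
    ∫ t in (0 : ℝ)..T, ‖D.gradST v t‖ ^ 2
      = ∑ n ∈ Finset.range D.N, D.dt * ‖D.grad (v (n + 1))‖ ^ 2 := by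
  have hdt := D.dt_pos hT
  have hle : ∀ n, D.time n ≤ D.time (n + 1) := fun n => by
    simp only [time, Nat.cast_add, Nat.cast_one]
    nlinarith
  have hconst : ∀ n, EqOn (fun _ => ‖D.grad (v (n + 1))‖ ^ 2) (fun t => ‖D.gradST v t‖ ^ 2)
      (uIoc (D.time n) (D.time (n + 1))) := fun n t ht => by
    rw [uIoc_of_le (hle n)] at ht
    have : ⌈t / D.dt⌉₊ = n + 1 := by
      rw [Nat.ceil_eq_iff (by omega)]
      simp only [time, Nat.cast_add, Nat.cast_one] at ht
      rw [lt_div_iff₀ hdt, div_le_iff₀ hdt]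
      simpa using ht
    simp only [gradST, this]
  have h1 := intervalIntegral.sum_integral_adjacent_intervals (μ := volume) (a := D.time)
    (n := D.N) (f := fun t => ‖D.gradST v t‖ ^ 2)
    fun n _ => (intervalIntegrable_const (c := ‖D.grad (v (n + 1))‖ ^ 2)).congr (hconst n)
  have h0 : D.time 0 = 0 := by simp [time]
  have hN : D.time D.N = T := D.N_mul_dt
  rw [h0, hN] at h1
  rw [← h1]
  refine Finset.sum_congr rfl fun n _ => ?_
  rw [intervalIntegral.integral_congr_ae (g := fun _ => ‖D.grad (v (n + 1))‖ ^ 2)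
    (ae_of_all _ fun t ht => (hconst n ht).symm), intervalIntegral.integral_const,
    smul_eq_mul]
  simp [time]
  left
  ring

lemma energy_eq (hT : 0 < T) {ζ : ℝ → ℝ} (hζ : ζ 0 = 0) (u : ℕ → D.X) :
    D.energy ζ u = (⨆ n : Fin (D.N + 1), D.xi ζ (u n))
      + ∑ n ∈ Finset.range D.N, D.dt * ‖D.grad (D.app ζ (u (n + 1)))‖ ^ 2
      + ∑ n ∈ Finset.range D.N, D.jump ζ (u (n + 1)) (u n) := by
  simp only [energy, integral_Xi_recon, D.integral_gradST hT, D.integral_sq_recon_sub hζ]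

section Nonlinearity

variable {ζ : ℝ → ℝ} {K : ℝ≥0} (hζ : IsNonlinearity ζ K)
include hζ

lemma continuous_xi : Continuous (D.xi ζ) :=
  continuous_finsetSum _ fun i _ => (hζ.continuous_Xi.comp (continuous_apply i)).mul_const _

lemma measurable_jump {Ω : Type*} [MeasurableSpace Ω] {v w : Ω → D.X} (hv : Measurable v)
    (hw : Measurable w) : Measurable fun ω => D.jump ζ (v ω) (w ω) := by
  have := hζ.lipschitz.continuous.measurable
  exact Finset.measurable_fun_sum _ fun i _ => Measurable.mul_const (Measurable.pow_const
    ((this.comp ((measurable_pi_apply i).comp hv)).sub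
      (this.comp ((measurable_pi_apply i).comp hw))) 2) _

lemma xi_nonneg (v : D.X) : 0 ≤ D.xi ζ v :=
  Finset.sum_nonneg fun i _ => mul_nonneg (hζ.Xi_nonneg _) (D.mass_nonneg i)

lemma xi_le {L : ℝ} (hL : K ≤ L) (v : D.X) : D.xi ζ v ≤ L / 2 * ‖D.reconL2 v‖ ^ 2 := by
  rw [norm_sq_reconL2, Finset.mul_sum]
  refine Finset.sum_le_sum fun i _ => ?_
  have := mul_le_mul_of_nonneg_right (hζ.Xi_le hL (v i)) (D.mass_nonneg i)
  linarith

lemma norm_sq_reconL2_app_le {L : ℝ} (hL : K ≤ L) (hL0 : 0 < L) (v : D.X) :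
    ‖D.reconL2 (D.app ζ v)‖ ^ 2 ≤ 2 * L * D.xi ζ v := by
  rw [norm_sq_reconL2, xi, Finset.mul_sum]
  refine Finset.sum_le_sum fun i _ => ?_
  have := mul_le_mul_of_nonneg_right (hζ.sq_le hL hL0 (v i)) (D.mass_nonneg i)
  simp only [app]
  linarith

/-- One step of the energy estimate: the scheme tested with `ζ` of the new iterate. -/
lemma energy_step {Λ : E d → E d →L[ℝ] E d} (hΛ : IsDiffusionTensor Θ Λ) {α L : ℝ}
    (hα : ∀ᵐ x ∂Θ.μ, ∀ ξ : E d, α * ‖ξ‖ ^ 2 ≤ inner ℝ (Λ x ξ) ξ) (hT : 0 < T) (hL : K ≤ L)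
    (hL0 : 0 < L) {a b : D.X} {F : L2 Θ}
    (h : ∫ x, (D.recon a x - D.recon b x) * D.recon (D.app ζ a) x ∂Θ.μ
        + D.dt * pairing Λ (D.grad (D.app ζ a)) (D.grad (D.app ζ a))
      = ∫ x, F x * D.recon (D.app ζ a) x ∂Θ.μ) :
    D.xi ζ a + (D.jump ζ a b / (4 * L) + α * (D.dt * ‖D.grad (D.app ζ a)‖ ^ 2)) ≤
      D.xi ζ b + inner ℝ F (D.reconL2 (D.app ζ b)) + L * ‖F‖ ^ 2 := by
  have hdt := D.dt_pos hT
  simp only [recon_sub, recon_mul, integral_recon, ← inner_reconL2] at h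
  have h1 : D.xi ζ a - D.xi ζ b + D.jump ζ a b / (2 * L)
      ≤ ∑ i, (a - b) i * D.app ζ a i * D.mass i := by
    rw [xi, xi, jump, Finset.sum_div, ← Finset.sum_sub_distrib, ← Finset.sum_add_distrib]
    refine Finset.sum_le_sum fun i _ => ?_
    have := mul_le_mul_of_nonneg_right (hζ.Xi_sub_add_sq_le hL hL0 (a i) (b i)) (D.mass_nonneg i)
    simp only [app, Pi.sub_apply]
    refine le_of_eq_of_le ?_ this
    ring
  have h2 := mul_le_mul_of_nonneg_left (hΛ.le_pairing_self hα (D.grad (D.app ζ a))) hdt.le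
  -- The old iterate b is known before the noise increment, so the first term is the future
  -- martingale increment.
  have h3 : inner ℝ F (D.reconL2 (D.app ζ a)) = inner ℝ F (D.reconL2 (D.app ζ b))
      + inner ℝ F (D.reconL2 (D.app ζ a - D.app ζ b)) := by
    rw [← inner_add_right]
    congr 1
    exact (by simp : D.reconLM (D.app ζ a)
      = D.reconLM (D.app ζ b) + D.reconLM (D.app ζ a - D.app ζ b))
  have h4 : ‖D.reconL2 (D.app ζ a - D.app ζ b)‖ ^ 2 = D.jump ζ a b := by
    rw [norm_sq_reconL2]
    rfl
  have h5 := real_inner_le_norm F (D.reconL2 (D.app ζ a - D.app ζ b))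
  -- Young's inequality, weighted to use exactly half of the available jump/(2L).
  have h6 : ‖F‖ * ‖D.reconL2 (D.app ζ a - D.app ζ b)‖ ≤ L * ‖F‖ ^ 2 + D.jump ζ a b / (4 * L) := by
    rw [← h4, ← sub_nonneg]
    have : L * ‖F‖ ^ 2 + ‖D.reconL2 (D.app ζ a - D.app ζ b)‖ ^ 2 / (4 * L)
        - ‖F‖ * ‖D.reconL2 (D.app ζ a - D.app ζ b)‖
        = (2 * L * ‖F‖ - ‖D.reconL2 (D.app ζ a - D.app ζ b)‖) ^ 2 / (4 * L) := by
      field_simp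
      ring
    rw [this]
    positivity
  have h7 : D.jump ζ a b / (2 * L) = D.jump ζ a b / (4 * L) + D.jump ζ a b / (4 * L) := by
    field_simp
    ring
  linarith

end Nonlinearity

end GradDisc

/-- The scheme holds almost surely for all test vectors simultaneously. -/
lemma IsSolution.ae_forall_scheme {d : ℕ} {Θ : Domain d} {T : ℝ} {Y : Set (L2 Θ)}
    {K : Type*} [NormedAddCommGroup K] [InnerProductSpace ℝ K] {Ω : Type*} [MeasurableSpace Ω]
    {D : GradDisc Θ T Y} {ζ : ℝ → ℝ} {Λ : E d → E d →L[ℝ] E d} {f : L2 Θ → K →L[ℝ] L2 Θ} {u₀ : Y}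
    {P : Measure Ω} {W : ℝ → Ω → K} {u : ℕ → Ω → D.X} (h : IsSolution D ζ Λ f u₀ P W u)
    (hΛ : IsDiffusionTensor Θ Λ) :
    ∀ᵐ ω ∂P, ∀ φ : D.X, ∀ n < D.N,
      ∫ x, (D.recon (u (n + 1) ω) x - D.recon (u n ω) x) * D.recon φ x ∂Θ.μ
        + D.dt * pairing Λ (D.grad (D.app ζ (u (n + 1) ω))) (D.grad φ)
      = ∫ x, (f (D.reconL2 (D.app ζ (u n ω))) (W (D.time (n + 1)) ω - W (D.time n) ω) : L2 Θ) x
          * D.recon φ x ∂Θ.μ := by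
  classical
  -- Finitely many unit vectors cost one null set; both sides are linear in φ, so agreement there
  -- suffices.
  filter_upwards [ae_all_iff.2 fun i => h.scheme (Pi.single i 1)] with ω hω φ n hn
  let l : D.X →ₗ[ℝ] ℝ :=
    { toFun := fun φ => ∑ i, (u (n + 1) ω - u n ω) i * φ i * D.mass i
        + D.dt * pairing Λ (D.grad (D.app ζ (u (n + 1) ω))) (D.grad φ)
      map_add' := fun v w => by
        simp only [map_add, hΛ.pairing_add, Pi.add_apply, mul_add, add_mul,
          Finset.sum_add_distrib]
        ring
      map_smul' := fun c v => by
        simp only [map_smul, pairing_smul, Pi.smul_apply, smul_eq_mul, RingHom.id_apply, mul_add,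
          Finset.mul_sum]
        congr 1
        · exact Finset.sum_congr rfl fun i _ => by ring
        · ring }
  let r : D.X →ₗ[ℝ] ℝ := (innerSL ℝ (f (D.reconL2 (D.app ζ (u n ω)))
    (W (D.time (n + 1)) ω - W (D.time n) ω))).toLinearMap ∘ₗ D.reconLM
  have hlr : l = r := by
    refine LinearMap.pi_ext' fun i => LinearMap.ext_ring ?_
    have := hω i n hn
    simp only [GradDisc.recon_sub, GradDisc.recon_mul, GradDisc.integral_recon,
      ← GradDisc.inner_reconL2] at this
    exact this
  have := LinearMap.congr_fun hlr φ
  simp only [GradDisc.recon_sub, GradDisc.recon_mul, GradDisc.integral_recon,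
      ← GradDisc.inner_reconL2]
  exact this

/-! ### The a priori estimate -/

namespace GradDisc

variable {d : ℕ} {Θ : Domain d} {T : ℝ} {Y : Set (L2 Θ)} (D : GradDisc Θ T Y)

/-- The time points as a monotone sequence in `[0,T]`, constant after the final time. -/
noncomputable def grid (hT : 0 < T) (n : ℕ) : Icc (0 : ℝ) T :=
  ⟨D.time (min n D.N), mul_nonneg (Nat.cast_nonneg _) (D.dt_pos hT).le, by
    refine le_of_le_of_eq ?_ D.N_mul_dt
    exact mul_le_mul_of_nonneg_right (Nat.cast_le.2 (min_le_right _ _)) (D.dt_pos hT).le⟩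

lemma grid_of_le (hT : 0 < T) {n : ℕ} (hn : n ≤ D.N) : (D.grid hT n : ℝ) = D.time n := by
  simp [grid, hn]

lemma monotone_grid (hT : 0 < T) : Monotone (D.grid hT) := fun _ _ hij =>
  Subtype.mk_le_mk.2 <| mul_le_mul_of_nonneg_right
    (Nat.cast_le.2 (min_le_min_right _ hij)) (D.dt_pos hT).le

/-- The growth condition applies at w = Π v, because ζ(0) = 0 makes ζ commute with the
reconstruction. -/
lemma hsNormSq_le {κ K : Type*} [NormedAddCommGroup K] [InnerProductSpace ℝ K]
    {e : HilbertBasis κ ℝ K} {ζ : ℝ → ℝ} {f : L2 Θ → K →L[ℝ] L2 Θ} {C₁ C₂ : ℝ}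
    (hζ : ζ 0 = 0)
    (hC : ∀ w z : L2 Θ, Integrable (fun x => Xi ζ (w x)) Θ.μ → (z =ᵐ[Θ.μ] fun x => ζ (w x)) →
      hsNormSq e (f z) ≤ ENNReal.ofReal (C₂ * ∫ x, Xi ζ (w x) ∂Θ.μ + C₁)) (v : D.X) :
    hsNormSq e (f (D.reconL2 (D.app ζ v))) ≤ ENNReal.ofReal (C₂ * D.xi ζ v + C₁) := by
  have h1 : (fun x => Xi ζ (D.reconL2 v x)) =ᵐ[Θ.μ] D.recon (D.app (Xi ζ) v) := by
    filter_upwards [D.coeFn_reconL2 v] with x hx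
    rw [hx, D.recon_app (IsNonlinearity.Xi_zero ζ)]
  have h2 : D.reconL2 (D.app ζ v) =ᵐ[Θ.μ] fun x => ζ (D.reconL2 v x) := by
    filter_upwards [D.coeFn_reconL2 v, D.coeFn_reconL2 (D.app ζ v)] with x hx hx'
    rw [hx, hx', D.recon_app hζ]
  have h3 := hC _ _ (((D.memLp_recon (D.app (Xi ζ) v)).integrable (by norm_num)).congr h1.symm) h2
  rwa [integral_congr_ae h1, D.integral_recon] at h3

lemma measurable_sigmaW {K Ω : Type*} [NormedAddCommGroup K] (W : ℝ → Ω → K) {k n : ℕ} (hk : k ≤ n) :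
    @Measurable _ _ (D.sigmaW W n) (borel K) (W (D.time k)) :=
  Measurable.of_comap_le (le_iSup₂_of_le (f := fun (k : ℕ) (_ : k ≤ n) =>
    MeasurableSpace.comap (W (D.time k)) (borel K)) k hk le_rfl)

lemma monotone_sigmaW {K Ω : Type*} [NormedAddCommGroup K] (W : ℝ → Ω → K) : Monotone (D.sigmaW W) := fun _ _ hij =>
  iSup₂_le fun k hk => le_iSup₂_of_le (f := fun (k : ℕ) (_ : k ≤ _) =>
    MeasurableSpace.comap (W (D.time k)) (borel K)) k (hk.trans hij) le_rfl

end GradDisc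

/-- Martingale property of the noise integrated over one time step. -/
lemma integral_mul_inner_indep_eq_zero {κ K H S Ω : Type*} [NormedAddCommGroup K]
    [InnerProductSpace ℝ K] [MeasurableSpace K] [BorelSpace K] [SecondCountableTopology K]
    [CompleteSpace K] [Countable κ] [NormedAddCommGroup H] [InnerProductSpace ℝ H]
    [TopologicalSpace S] [SecondCountableTopology S] [MeasurableSpace S] [BorelSpace S]
    {mΩ : MeasurableSpace Ω} {P : Measure Ω} [IsProbabilityMeasure P] {e : HilbertBasis κ ℝ K}
    {σ : κ → ℝ} {s : Ω → ℝ} {U : Ω → S} {V : Ω → K} (hU : Measurable fun ω => (s ω, U ω))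
    (hV : Measurable V) (hUV : IndepFun (fun ω => (s ω, U ω)) V P)
    (hcov : HasDiagCov (P.map V) e σ) {A : S → K →L[ℝ] H} {z : S → H}
    (hA : Continuous fun p : S × K => (inner ℝ (A p.1 p.2) (z p.1) : ℝ))
    (hi : Integrable (fun ω => s ω * inner ℝ (A (U ω) (V ω)) (z (U ω))) P) :
    ∫ ω, s ω * inner ℝ (A (U ω) (V ω)) (z (U ω)) ∂P = 0 := by
  let l : ℝ × S → K →L[ℝ] ℝ := fun p => p.1 • (innerSL ℝ (z p.2)).comp (A p.2)
  have hl : ∀ p w, l p w = p.1 * (inner ℝ (A p.2 w) (z p.2) : ℝ) := fun p w => by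
    rw [real_inner_comm]
    rfl
  have hlc : Continuous fun p : (ℝ × S) × K => l p.1 p.2 := by
    simp only [hl]
    exact (continuous_fst.comp continuous_fst).mul
      (hA.comp ((continuous_snd.comp continuous_fst).prodMk continuous_snd))
  have h1 := integral_linear_indep_eq_zero hU hV hUV hcov (l := l) hlc.measurable
    (by simpa only [hl] using hi)
  simpa only [hl] using h1

/-! ### Solutions of the scheme satisfy the abstract energy inequality -/

section Estimate

variable {d : ℕ} {Θ : Domain d} {T : ℝ} {Y : Set (L2 Θ)} {D : GradDisc Θ T Y}
  {κ K : Type*} [NormedAddCommGroup K] [InnerProductSpace ℝ K] [CompleteSpace K]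
  [TopologicalSpace.SeparableSpace K] [Countable κ] {Ω : Type*} {mΩ : MeasurableSpace Ω}
  {P : Measure Ω} [IsProbabilityMeasure P] {𝓕 : Filtration (Icc (0 : ℝ) T) mΩ}
  {e : HilbertBasis κ ℝ K} {q : κ → ℝ} {W : ℝ → Ω → K} {ζ : ℝ → ℝ} {Lip : ℝ≥0}
  {Λ : E d → E d →L[ℝ] E d} {f : L2 Θ → K →L[ℝ] L2 Θ} {u₀ : Y} {u : ℕ → Ω → D.X}

/-- The energy, the noise and the dissipation of a solution of the gradient scheme are related
by the discrete energy inequality. -/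
lemma IsSolution.isEnergyProcess (h : IsSolution D ζ Λ f u₀ P W u) (hT : 0 < T)
    (hζ : IsNonlinearity ζ Lip) (hΛ : IsDiffusionTensor Θ Λ) (hf : IsNoiseCoefficient e ζ f)
    (hW : IsQWiener P 𝓕 e q W) {α L C₁ C₂ X₀ : ℝ} (hα0 : 0 < α)
    (hα : ∀ᵐ x ∂Θ.μ, ∀ ξ : E d, α * ‖ξ‖ ^ 2 ≤ inner ℝ (Λ x ξ) ξ) (hL : Lip ≤ L) (hL0 : 0 < L)
    (hC₁ : 0 < C₁) (hC₂ : 0 < C₂)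
    (hC : ∀ w z : L2 Θ, Integrable (fun x => Xi ζ (w x)) Θ.μ → (z =ᵐ[Θ.μ] fun x => ζ (w x)) →
      hsNormSq e (f z) ≤ ENNReal.ofReal (C₂ * ∫ x, Xi ζ (w x) ∂Θ.μ + C₁))
    (hX₀ : D.xi ζ (D.interp u₀) ≤ X₀) :
    IsEnergyProcess P (D.sigmaW W) D.N D.dt L (2 * L) ((∑' k, q k ^ 2 + 1) * C₁)
      ((∑' k, q k ^ 2 + 1) * C₂) X₀ (fun n ω => D.xi ζ (u n ω))
      (fun n ω => ‖f (D.reconL2 (D.app ζ (u n ω))) (W (D.time (n + 1)) ω - W (D.time n) ω)‖ ^ 2)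
      (fun n ω => inner ℝ (f (D.reconL2 (D.app ζ (u n ω)))
        (W (D.time (n + 1)) ω - W (D.time n) ω)) (D.reconL2 (D.app ζ (u n ω))))
      (fun n ω => D.jump ζ (u (n + 1) ω) (u n ω) / (4 * L)
        + α * (D.dt * ‖D.grad (D.app ζ (u (n + 1) ω))‖ ^ 2)) := by
  borelize K
  have : SecondCountableTopology K := UniformSpace.secondCountable_of_separable K
  have hdt := D.dt_pos hT
  set z : D.X → L2 Θ := fun v => D.reconL2 (D.app ζ v) with hz
  have hzc : Continuous z :=
    D.continuous_reconL2.comp (D.continuous_app hζ.lipschitz.continuous)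
  have hfz : Continuous fun v => f (z v) := hf.continuous_opNorm.comp hzc
  have hfc : Continuous fun p : D.X × K => f (z p.1) p.2 :=
    isBoundedBilinearMap_apply.continuous.comp
      ((hfz.comp continuous_fst).prodMk continuous_snd)
  have hψ : Continuous fun p : D.X × K => (inner ℝ (f (z p.1) p.2) (z p.1) : ℝ) :=
    hfc.inner (hzc.comp continuous_fst)
  have hWm : ∀ n ≤ D.N, Measurable (W (D.time n)) := fun n hn => by
    rw [← D.grid_of_le hT hn]
    exact hW.measurable_apply _
  have hle : ∀ n ≤ D.N, D.sigmaW W n ≤ mΩ := fun n hn =>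
    iSup₂_le fun k hk => (hWm k (hk.trans hn)).comap_le
  have hum : ∀ n ≤ D.N, Measurable (u n) := fun n hn => (h.adapted n hn).mono (hle n hn) le_rfl
  have hg0 : ((D.grid hT 0 : Icc (0 : ℝ) T) : ℝ) = 0 := by
    rw [D.grid_of_le hT (Nat.zero_le _)]
    simp [GradDisc.time]
  have hV : ∀ n < D.N, Measurable fun ω => W (D.time (n + 1)) ω - W (D.time n) ω := fun n hn =>
    (hWm _ hn).sub (hWm _ hn.le)
  have hind : ∀ n < D.N, Indep (D.sigmaW W n)
      (MeasurableSpace.comap (fun ω => W (D.time (n + 1)) ω - W (D.time n) ω) inferInstance) P :=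
    fun n hn => by
      have h1 := hW.indep_increment (D.monotone_grid hT) hg0 n
      rw [D.grid_of_le hT hn, D.grid_of_le hT hn.le] at h1
      refine indep_of_indep_of_le_left h1 (iSup₂_le fun k hk => ?_)
      rw [← D.grid_of_le hT (hk.trans hn.le)]
      exact le_iSup₂_of_le (f := fun (k : ℕ) (_ : k ≤ n) =>
        MeasurableSpace.comap (W (D.grid hT k)) (borel K)) k hk le_rfl
  have hcov : ∀ n < D.N, HasDiagCov (P.map fun ω => W (D.time (n + 1)) ω - W (D.time n) ω) e
      fun k => D.dt * q k ^ 2 := fun n hn => by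
    have h1 := hW.hasDiagCov_increment (D.monotone_grid hT) hg0 n
    rw [D.grid_of_le hT hn, D.grid_of_le hT hn.le] at h1
    have h2 : D.time (n + 1) - D.time n = D.dt := by
      simp only [GradDisc.time, Nat.cast_add, Nat.cast_one]
      ring
    rwa [h2] at h1
  refine ⟨D.monotone_sigmaW W, hle, fun n ω => D.xi_nonneg hζ _, fun n ω => sq_nonneg _,
    fun n ω => ?_, fun n hn => (D.continuous_xi hζ).measurable.comp (h.adapted n hn),
    fun n hn => ?_, fun n hn ω => ?_, fun n hn => ?_, fun n hn hx => ?_, fun n hn s hs hi => ?_,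
    fun ω => ?_⟩
  · have := D.jump_nonneg ζ (u (n + 1) ω) (u n ω)
    positivity
  · have h1 : Measurable[D.sigmaW W (n + 1)] (u n) :=
      (h.adapted n hn.le).mono (D.monotone_sigmaW W (Nat.le_succ n)) le_rfl
    have h3 : Measurable[D.sigmaW W (n + 1)] (W (D.time (n + 1))) :=
      D.measurable_sigmaW W le_rfl
    have h4 : Measurable[D.sigmaW W (n + 1)] (W (D.time n)) :=
      D.measurable_sigmaW W (Nat.le_succ n)
    have h2 : Measurable[D.sigmaW W (n + 1)] fun ω => W (D.time (n + 1)) ω - W (D.time n) ω :=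
      h3.sub h4
    have h5 : Measurable fun p : D.X × K => (inner ℝ (f (z p.1) p.2) (z p.1) : ℝ) := hψ.measurable
    have h6 : Measurable[D.sigmaW W (n + 1)] fun ω =>
      (u n ω, W (D.time (n + 1)) ω - W (D.time n) ω) := Measurable.prodMk h1 h2
    have h7 := h5.comp h6
    exact h7
  · have h1 := D.norm_sq_reconL2_app_le hζ hL hL0 (u n ω)
    have h2 := abs_real_inner_le_norm (f (z (u n ω)) (W (D.time (n + 1)) ω - W (D.time n) ω))
      (z (u n ω))
    rw [← sq_abs]
    calc _ ≤ (‖f (z (u n ω)) (W (D.time (n + 1)) ω - W (D.time n) ω)‖ * ‖z (u n ω)‖) ^ 2 := by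
          gcongr
      _ = ‖z (u n ω)‖ ^ 2 * ‖f (z (u n ω)) (W (D.time (n + 1)) ω - W (D.time n) ω)‖ ^ 2 := by ring
      _ ≤ _ := by gcongr
  · filter_upwards [h.ae_forall_scheme hΛ] with ω hω
    exact D.energy_step hζ hΛ hα hT hL hL0 (hω _ n hn)
  -- Noise bound: the iterate is a function of the past, so the one-step Itô inequality applies with
  -- covariance trace δt ∑ q².
  · have hUV : IndepFun (u n) (fun ω => W (D.time (n + 1)) ω - W (D.time n) ω) P :=
      indep_of_indep_of_le_left (hind n hn) (h.adapted n hn.le).comap_le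
    have hxi := (D.continuous_xi hζ).measurable
    have h1 := lintegral_sq_norm_indep_le (hum n hn.le) (hV n hn) hUV (hcov n hn)
      (A := fun v => f (z v)) hfc.enorm.measurable
      (g := fun v => ENNReal.ofReal (C₂ * D.xi ζ v + C₁))
      ((hxi.const_mul C₂).add_const C₁).ennreal_ofReal (D.hsNormSq_le hζ.map_zero hC)
    have hnn : ∀ ω, 0 ≤ C₂ * D.xi ζ (u n ω) + C₁ := fun ω => by
      have := D.xi_nonneg hζ (u n ω)
      positivity
    have hint : Integrable (fun ω => C₂ * D.xi ζ (u n ω) + C₁) P :=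
      (hx.const_mul C₂).add (integrable_const C₁)
    rw [← ofReal_integral_eq_lintegral_ofReal hint (ae_of_all _ hnn),
      ← ENNReal.ofReal_mul (tsum_nonneg fun k => by positivity)] at h1
    have hym : Measurable fun ω =>
        ‖f (z (u n ω)) (W (D.time (n + 1)) ω - W (D.time n) ω)‖ ^ 2 :=
      (hfc.norm.measurable.comp ((hum n hn.le).prodMk (hV n hn))).pow_const 2
    have h2 : ∫⁻ ω, ENNReal.ofReal (‖f (z (u n ω)) (W (D.time (n + 1)) ω - W (D.time n) ω)‖ ^ 2) ∂P
        ≤ ENNReal.ofReal ((∑' k, D.dt * q k ^ 2) * ∫ ω, (C₂ * D.xi ζ (u n ω) + C₁) ∂P) := by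
      simpa only [ENNReal.ofReal_pow (norm_nonneg _), ofReal_norm] using h1
    have hB : 0 ≤ ∫ ω, (C₂ * D.xi ζ (u n ω) + C₁) ∂P := integral_nonneg hnn
    have hQ : 0 ≤ ∑' k, q k ^ 2 := tsum_nonneg fun k => sq_nonneg _
    refine ⟨⟨hym.aestronglyMeasurable, ?_⟩, ?_⟩
    · rw [hasFiniteIntegral_iff_ofReal (ae_of_all _ fun ω => sq_nonneg _)]
      exact h2.trans_lt ENNReal.ofReal_lt_top
    · rw [integral_eq_lintegral_of_nonneg_ae (ae_of_all _ fun ω => sq_nonneg _)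
        hym.aestronglyMeasurable]
      refine (ENNReal.toReal_le_of_le_ofReal
        (mul_nonneg (tsum_nonneg fun k => by positivity) hB) h2).trans ?_
      rw [tsum_mul_left, mul_assoc]
      refine mul_le_mul_of_nonneg_left ?_ hdt.le
      rw [integral_add (hx.const_mul C₂) (integrable_const _), integral_const_mul,
        integral_const] at hB ⊢
      simp only [probReal_univ, one_smul] at hB ⊢
      linarith
  -- The weight is bundled with the iterate: the pair is known at time n, and the product is linear
  -- in the increment.
  · have hU : Measurable[D.sigmaW W n] fun ω => (s ω, u n ω) :=
      Measurable.prodMk hs (h.adapted n hn.le)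
    have hUV : IndepFun (fun ω => (s ω, u n ω))
        (fun ω => W (D.time (n + 1)) ω - W (D.time n) ω) P :=
      indep_of_indep_of_le_left (hind n hn) hU.comap_le
    exact integral_mul_inner_indep_eq_zero (hU.mono (hle n hn.le) le_rfl) (hV n hn) hUV
      (hcov n hn) (A := fun v => f (z v)) (z := z) hψ hi
  · rw [h.init]
    exact hX₀

end Estimate

/-! ### Uniform constants and the expected energy -/

section Main

variable {d : ℕ} {Θ : Domain d} {T : ℝ} {Y : Set (L2 Θ)} {ζ : ℝ → ℝ} {Lip : ℝ≥0}

/-- The energies of the discrete initial data are bounded along a consistent sequence. -/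
lemma Consistent.exists_xi_interp_le {Λ : E d → E d →L[ℝ] E d} {D : ℕ → GradDisc Θ T Y}
    (h : Consistent ζ Λ D) (hζ : IsNonlinearity ζ Lip) (φ : Y) :
    ∃ X₀, 0 ≤ X₀ ∧ ∀ m, (D m).xi ζ ((D m).interp φ) ≤ X₀ := by
  -- Convergent interpolants are bounded in L², and Ξ(z) ≤ Lip z²/2 transfers this to the energy.
  obtain ⟨B, hB⟩ := (h.interp φ).norm.bddAbove_range
  have hB' : ∀ m, ‖(D m).reconL2 ((D m).interp φ)‖ ≤ B := fun m => hB ⟨m, rfl⟩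
  refine ⟨(Lip : ℝ) / 2 * B ^ 2, by positivity, fun m => ?_⟩
  refine ((D m).xi_le hζ le_rfl _).trans ?_
  have := hB' m
  gcongr

/-- The functional of the estimate is controlled by any bound on the maximal energy and the total
dissipation. -/
lemma GradDisc.energy_le (D : GradDisc Θ T Y) (hT : 0 < T) (hζ : IsNonlinearity ζ Lip)
    {α L Z : ℝ} (hα : 0 < α) (hL : 0 < L) {u : ℕ → D.X}
    (h : ∀ n ≤ D.N, D.xi ζ (u n) + ∑ k ∈ Finset.range D.N, (D.jump ζ (u (k + 1)) (u k) / (4 * L)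
      + α * (D.dt * ‖D.grad (D.app ζ (u (k + 1)))‖ ^ 2)) ≤ Z) :
    0 ≤ D.energy ζ u ∧ D.energy ζ u ≤ (1 + 1 / α + 4 * L) * Z := by
  have hdt := D.dt_pos hT
  rw [D.energy_eq hT hζ.map_zero]
  set G := ∑ n ∈ Finset.range D.N, D.dt * ‖D.grad (D.app ζ (u (n + 1)))‖ ^ 2 with hG
  set J := ∑ n ∈ Finset.range D.N, D.jump ζ (u (n + 1)) (u n) with hJ
  have hG0 : 0 ≤ G := Finset.sum_nonneg fun n _ => by positivity
  have hJ0 : 0 ≤ J := Finset.sum_nonneg fun n _ => D.jump_nonneg ζ _ _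
  simp only [Finset.sum_add_distrib, ← Finset.mul_sum, ← Finset.sum_div, ← hG, ← hJ] at h
  have hx0 : 0 ≤ ⨆ n : Fin (D.N + 1), D.xi ζ (u n) :=
    Real.iSup_nonneg fun n => D.xi_nonneg hζ _
  have hx : ⨆ n : Fin (D.N + 1), D.xi ζ (u n) ≤ Z - (J / (4 * L) + α * G) :=
    ciSup_le fun n => by
      have := h n (Nat.lt_succ_iff.1 n.2)
      linarith
  have h1 : 0 ≤ J / (4 * L) := by positivity
  have h2 : 0 ≤ α * G := by positivity
  refine ⟨by positivity, ?_⟩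
  have hxZ : (⨆ n : Fin (D.N + 1), D.xi ζ (u n)) ≤ Z := by linarith
  have hGZ : G ≤ 1 / α * Z := by
    have h3 : α * G ≤ Z := by linarith
    calc G = 1 / α * (α * G) := by field_simp
      _ ≤ _ := by gcongr
  have hJZ : J ≤ 4 * L * Z := by
    have h3 : J / (4 * L) ≤ Z := by linarith
    rw [div_le_iff₀ (by positivity)] at h3
    linarith
  linarith

lemma GradDisc.measurable_energy (D : GradDisc Θ T Y) (hT : 0 < T) (hζ : IsNonlinearity ζ Lip)
    {Ω : Type*} [MeasurableSpace Ω] {u : ℕ → Ω → D.X} (hu : ∀ n ≤ D.N, Measurable (u n)) :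
    Measurable fun ω => D.energy ζ fun n => u n ω := by
  simp only [D.energy_eq hT hζ.map_zero]
  refine Measurable.add (Measurable.add ?_ ?_) ?_
  · exact Measurable.iSup fun n => (D.continuous_xi hζ).measurable.comp
      (hu n (Nat.lt_succ_iff.1 n.2))
  · refine Finset.measurable_fun_sum _ fun n hn => Measurable.const_mul ?_ _
    have hc : Continuous fun v => ‖D.grad (D.app ζ v)‖ ^ 2 :=
      ((D.continuous_grad.comp (D.continuous_app hζ.lipschitz.continuous)).norm).pow 2
    exact hc.measurable.comp (hu (n + 1) (Finset.mem_range.1 hn))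
  · refine Finset.measurable_fun_sum _ fun n hn => ?_
    have hn := Finset.mem_range.1 hn
    exact D.measurable_jump hζ (hu (n + 1) hn) (hu n hn.le)

end Main

end Stefan

theorem lemma3p3 {d : ℕ} (hd : 1 ≤ d) (Θ : Stefan.Domain d) {T : ℝ} (hT : 0 < T)
    -- the nonlinearity and the diffusion tensor
    {ζ : ℝ → ℝ} {Lip : ℝ≥0} (hζ : Stefan.IsNonlinearity ζ Lip)
    {Λ : Stefan.E d → Stefan.E d →L[ℝ] Stefan.E d} (hΛ : Stefan.IsDiffusionTensor Θ Λ)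
    -- the initial datum
    {u₀ : Stefan.E d → ℝ} (hu₀ : AEStronglyMeasurable u₀ Θ.μ)
    (hΞu₀ : Integrable (fun x => Stefan.Xi ζ (u₀ x)) Θ.μ)
    -- the covariance of the noise, and its coefficient
    {K : Type v} [NormedAddCommGroup K] [InnerProductSpace ℝ K] [CompleteSpace K]
    [TopologicalSpace.SeparableSpace K]
    {κ : Type w} [Countable κ] (e : HilbertBasis κ ℝ K) (q : κ → ℝ)
    {f : Stefan.L2 Θ → K →L[ℝ] Stefan.L2 Θ} (hf : Stefan.IsNoiseCoefficient e ζ f)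
    -- the sequence of gradient discretisations
    {Y : Set (Stefan.L2 Θ)} (hY : (hζ.memLp hu₀ hΞu₀).toLp u₀ ∈ Y)
    (D : ℕ → Stefan.GradDisc Θ T Y) (hcons : Stefan.Consistent ζ Λ D)
    (hconf : Stefan.LimitConforming D) (hcomp : Stefan.Compact D) :
    ∃ C : ℝ, 0 < C ∧
      ∀ (Ω : Type u) (mΩ : MeasurableSpace Ω) (P : Measure Ω) [IsProbabilityMeasure P]
        (𝓕 : Filtration (Set.Icc (0 : ℝ) T) mΩ) (W : ℝ → Ω → K),
        Stefan.IsQWiener P 𝓕 e q W →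
        ∀ (m : ℕ) (u : ℕ → Ω → (D m).X),
          Stefan.IsSolution (D m) ζ Λ f ⟨_, hY⟩ P W u →
          Integrable (fun ω => (D m).energy ζ (fun n => u n ω)) P ∧
            ∫ ω, (D m).energy ζ (fun n => u n ω) ∂P ≤ C := by
  obtain ⟨X₀, hX₀0, hX₀⟩ := hcons.exists_xi_interp_le hζ ⟨_, hY⟩
  obtain ⟨α, hα0, b, -, hαb⟩ := hΛ.elliptic_bounded
  have hα : ∀ᵐ x ∂Θ.μ, ∀ ξ : Stefan.E d, α * ‖ξ‖ ^ 2 ≤ inner ℝ (Λ x ξ) ξ := by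
    filter_upwards [hαb] with x hx ξ using (hx ξ).1
  obtain ⟨C₁, hC₁, C₂, hC₂, hC⟩ := hf.growth
  set L : ℝ := Lip + 1 with hLdef
  have hL0 : 0 < L := by positivity
  have hL : (Lip : ℝ) ≤ L := by simp [hLdef]
  -- The added 1 keeps the Gronwall rate positive even when the noise vanishes.
  set Q : ℝ := ∑' k, q k ^ 2 + 1 with hQdef
  have hQ : 0 < Q := by
    have : 0 ≤ ∑' k, q k ^ 2 := tsum_nonneg fun k => sq_nonneg _
    positivity
  set B : ℝ := Q * C₂ * ((X₀ + Q * C₁ / (Q * C₂)) * Real.exp (T * (L * (Q * C₂)))) + Q * C₁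
    with hB
  -- The first factor undoes the weights 1, α and 1/(4L) of the maximum, the gradient and the jumps.
  -- The second bounds E Z with c₀ = 2L and N δt = T.
  refine ⟨(1 + 1 / α + 4 * L) * (3 * X₀ + 1 + (16 * (2 * L) + 3 * L) * (T * B)), by positivity, ?_⟩
  intro Ω mΩ P _ 𝓕 W hW m u hu
  have hp := hu.isEnergyProcess hT hζ hΛ hf hW hα0 hα hL hL0 hC₁ hC₂ hC (hX₀ m)
  obtain ⟨Z, hZi, hZ, hZle⟩ := hp.exists_integrable_bound (by positivity) ((D m).dt_pos hT) hL0
    (by positivity) (by positivity) (Y := B) (by rw [(D m).N_mul_dt])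
  rw [(D m).N_mul_dt] at hZ
  have hle : ∀ᵐ ω ∂P, 0 ≤ (D m).energy ζ (fun n => u n ω) ∧
      (D m).energy ζ (fun n => u n ω) ≤ (1 + 1 / α + 4 * L) * Z ω := by
    filter_upwards [hZle] with ω hω
    exact (D m).energy_le hT hζ hα0 hL0 hω
  have hi : Integrable (fun ω => (D m).energy ζ (fun n => u n ω)) P := by
    refine Integrable.mono' (hZi.const_mul (1 + 1 / α + 4 * L))
      ((D m).measurable_energy hT hζ fun n hn =>
        (hu.adapted n hn).mono (hp.le n hn) le_rfl).aestronglyMeasurable ?_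
    filter_upwards [hle] with ω hω
    rw [Real.norm_eq_abs, abs_of_nonneg hω.1]
    exact hω.2
  refine ⟨hi, ?_⟩
  calc ∫ ω, (D m).energy ζ (fun n => u n ω) ∂P
      ≤ ∫ ω, (1 + 1 / α + 4 * L) * Z ω ∂P := by
        refine integral_mono_ae hi (hZi.const_mul _) ?_
        filter_upwards [hle] with ω hω using hω.2
    _ = (1 + 1 / α + 4 * L) * ∫ ω, Z ω ∂P := integral_const_mul _ _
    _ ≤ _ := by gcongr
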